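/- **Proposition (LAN property).** Let $J\ge 1$ and $\upsilon_{\max}>0$, and let $\mathcal F_0$ be the space of continuous $2\pi$-periodic functions $f:\mathbb R\to\mathbb R$ with $\int_0^{2\pi}f(t)\frac{dt}{2\pi}=0$. Let $\mathcal A_0$ be the set of $(\theta,a,\upsilon)\in[0,2\pi]^J\times\mathbb R^J\times[-\upsilon_{\max},\upsilon_{\max}]^J$ with $\theta_1=0$, $\sum_{j=1}^J a_j^2=J$ and $a_1>0$. For $\alpha=(\theta,a,\upsilon,\sigma)\in\mathcal A_0\times(0,\infty)$ and $f\in\mathcal F_0$, let $\mathbb P^{(n)}_{\alpha,f}$ be the law of the independent observations $$Y_{i,j}=a_jf(t_i-\theta_j)+\upsilon_j+\sigma\varepsilon_{i,j},\qquad t_i=\tfrac{i-1}{n}2\pi,\quad 1\le i\le n,\ 1\le j\le J,$$ with $\varepsilon_{i,j}$ independent standard Gaussian. Let $\alpha^*=(\theta^*,a^*,\upsilon^*,\sigma^*)\in\mathcal A_0\times(0,\infty)$ and $f^*\in\mathcal F_0$ be such that $|\upsilon^*_j|<\upsilon_{\max}$ and $a_j^*\ne0$ for all $j$, and $f^*$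 is not constant and differentiable with continuous derivative $\partial f^*$. Put $\Lambda_n(\alpha,f)=\log\frac{d\mathbb P^{(n)}_{\alpha,f}}{d\mathbb P^{(n)}_{\alpha^*,f^*}}$. Consider the real vector space $\mathcal H=\mathbb R^{J-1}\times\mathbb R^{J-1}\times\mathbb R^J\times\mathbb R\times\mathcal F_0$ with elements $$h=\big((h_{\theta,j})_{2\le j\le J},(h_{a,j})_{2\le j\le J},(h_{\upsilon,j})_{1\le j\le J},h_\sigma,h_f\big),$$ and for $h\in\mathcal H$ define the functions $$A_1(h)=a_1^*h_f-\sum_{k=2}^Jh_{a,k}\frac{a_k^*}{a_1^*}f^*+h_{\upsilon,1},\qquad A_j(h)=a_j^*h_f+h_{a,j}f^*-h_{\theta,j}a_j^*\,\partial f^*+h_{\upsilon,j}\quad(2\le j\le J).$$ With $\langle u,v\rangle_{\mathbb L^2}=\int_0^{2\pi}u(t)v(t)\frac{dt}{2\pi}$, set $$\langle h,h'\rangle=2J\,\frac{h_\sigma h'_\sigma}{{\sigma^*}^2}+\frac1{{\sigma^*}^2}\sum_{j=1}^J\langle A_j(h),A_j(h')\rangle_{\mathbb L^2},\qquad \|h\|_{\mathcal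 H}^2=\langle h,h\rangle .$$ 1. $\langle\cdot,\cdot\rangle$ is an inner product on $\mathcal H$ (bilinear, symmetric, positive definite). 2. The model is locally asymptotically normal at $(\alpha^*,f^*)$, indexed by $\mathcal H$. With $\varepsilon_{i,j}=(Y_{i,j}-a_j^*f^*(t_i-\theta_j^*)-\upsilon_j^*)/\sigma^*$, let $$\Delta_n(h)=\frac1{\sqrt n}\sum_{i=1}^n\sum_{j=1}^J\Big\{\frac{h_\sigma}{\sigma^*}(\varepsilon_{i,j}^2-1)+\frac{A_j(h)(t_i-\theta_j^*)}{\sigma^*}\,\varepsilon_{i,j}\Big\}.$$ Then $\Delta_n(h)$ is linear in $h$, and for every $h\in\mathcal H$, under $\mathbb P^{(n)}_{\alpha^*,f^*}$, $\Delta_n(h)$ converges in distribution to $\mathcal N(0,\|h\|^2_{\mathcal H})$. Moreover, for every $h\in\mathcal H$ there is a sequence $(\alpha_n,f_n)\in\mathcal A_0\times(0,\infty)\times\mathcal F_0$, $\alpha_n=(\theta_n,a_n,\upsilon_n,\sigma_n)$, approaching $(\alpha^*,f^*)$ in the direction $h$, that is, as $n\to\infty$, $$\sqrt n(\theta_{n,j}-\theta_j^*)\to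 h_{\theta,j},\quad \sqrt n(a_{n,j}-a_j^*)\to h_{a,j}\quad(2\le j\le J),$$ $$\sqrt n(\upsilon_{n,j}-\upsilon_j^*)\to h_{\upsilon,j}\quad(1\le j\le J),\qquad \sqrt n(\sigma_n-\sigma^*)\to h_\sigma,\qquad \sqrt n(f_n-f^*)\to h_f\ \text{ uniformly on }\mathbb R$$ (where each shift $\theta_{n,j}$ may be replaced by $\theta_{n,j}+2\pi m_{n,j}$, $m_{n,j}\in\mathbb Z$, in its limit relation), such that $$\Lambda_n(\alpha_n,f_n)=\Delta_n(h)-\tfrac12\|h\|^2_{\mathcal H}+o_{\mathbb P}(1)\quad\text{under }\mathbb P^{(n)}_{\alpha^*,f^*}.$$ -/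

import Mathlib

open MeasureTheory ProbabilityTheory Filter Topology

noncomputable section

namespace ShapeInvariant

/-- The space `𝓕₀` of continuous `2π`-periodic functions `ℝ → ℝ` with vanishing mean
`c₀(f) = ∫₀^{2π} f(t) dt/(2π)`. -/
def F0 : Submodule ℝ (ℝ → ℝ) where
  carrier := {f | Continuous f ∧ Function.Periodic f (2 * Real.pi) ∧
    (∫ t in (0 : ℝ)..(2 * Real.pi), f t) / (2 * Real.pi) = 0}
  zero_mem' := ⟨continuous_const, fun _ => rfl, by simp⟩
  add_mem' := by
    rintro f g ⟨hf, pf, cf⟩ ⟨hg, pg, cg⟩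
    refine ⟨hf.add hg, pf.add pg, ?_⟩
    simp only [Pi.add_apply]
    rw [intervalIntegral.integral_add (hf.intervalIntegrable _ _) (hg.intervalIntegrable _ _),
      add_div, cf, cg, add_zero]
  smul_mem' := by
    rintro c f ⟨hf, pf, cf⟩
    refine ⟨hf.const_smul c, fun t => by simp [pf t], ?_⟩
    simp only [Pi.smul_apply, smul_eq_mul]
    rw [intervalIntegral.integral_const_mul, mul_div_assoc, cf, mul_zero]

/-- The finite-dimensional parameter `α = (θ, a, υ, σ)`. There are `J = K + 1` curves, indexed by
`Fin (K + 1)`; the index `0` stands for the reference curve `j = 1`, and `k.succ`, for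
`k : Fin K`, stands for the curves `j = 2, …, J`. -/
structure Param (K : ℕ) where
  θ : Fin (K + 1) → ℝ
  a : Fin (K + 1) → ℝ
  υ : Fin (K + 1) → ℝ
  σ : ℝ

/-- The parameter set `𝓐₀ × ℝ₊*`. -/
structure Param.IsAdmissible {K : ℕ} (υmax : ℝ) (α : Param K) : Prop where
  θ_mem : ∀ j, α.θ j ∈ Set.Icc 0 (2 * Real.pi)
  υ_mem : ∀ j, α.υ j ∈ Set.Icc (-υmax) υmax
  θ_ref : α.θ 0 = 0
  sum_sq : ∑ j, α.a j ^ 2 = (K + 1 : ℝ)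
  a_ref_pos : 0 < α.a 0
  σ_pos : 0 < α.σ

/-- The observation times `2π (i - 1) / n`, `i = 1, …, n`, with `i` counted from `0`. -/
def time (n : ℕ) (i : Fin n) : ℝ := (i : ℝ) / n * (2 * Real.pi)

/-- The regression function `a_j f(t - θ_j) + υ_j` of the `j`-th curve. -/
def mean {K : ℕ} (α : Param K) (f : F0) (t : ℝ) (j : Fin (K + 1)) : ℝ :=
  α.a j * f.1 (t - α.θ j) + α.υ j

/-- The Gaussian distribution on `ℝ^J` with covariance `σ² I_J` and mean
`(a_j f(t - θ_j) + υ_j)_j`, i.e. the product of its marginals. -/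
def pointLaw {K : ℕ} (α : Param K) (f : F0) (t : ℝ) : Measure (Fin (K + 1) → ℝ) :=
  Measure.pi fun j => gaussianReal (mean α f t j) (Real.toNNReal (α.σ ^ 2))

instance {K : ℕ} (α : Param K) (f : F0) (t : ℝ) : IsProbabilityMeasure (pointLaw α f t) := by
  unfold pointLaw; infer_instance

/-- The law `ℙ⁽ⁿ⁾_{α,f}` of the observations `(Y_{i,j})`, `i ≤ n`, `j ≤ J`. -/
def obsLaw {K : ℕ} (n : ℕ) (α : Param K) (f : F0) : Measure (Fin n → Fin (K + 1) → ℝ) :=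
  Measure.pi fun i => pointLaw α f (time n i)

instance {K : ℕ} (n : ℕ) (α : Param K) (f : F0) : IsProbabilityMeasure (obsLaw n α f) := by
  unfold obsLaw; infer_instance

/-- The standardized noise `ε_{i,j}`, as a function of the observations:
`Y_{i,j} = a_j f(t_i - θ_j) + υ_j + σ ε_{i,j}`. -/
def noise {K n : ℕ} (α : Param K) (f : F0) (y : Fin n → Fin (K + 1) → ℝ)
    (i : Fin n) (j : Fin (K + 1)) : ℝ :=
  (y i j - mean α f (time n i) j) / α.σ

/-- The log-likelihood ratio `Λ_n(α', f') = log (dℙ⁽ⁿ⁾_{α',f'} / dℙ⁽ⁿ⁾_{α,f})` with respect to the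
reference point `(α, f)`. -/
def logLikRatio {K : ℕ} (n : ℕ) (α : Param K) (f : F0) (α' : Param K) (f' : F0) :
    (Fin n → Fin (K + 1) → ℝ) → ℝ :=
  llr (obsLaw n α' f') (obsLaw n α f)

/-- The tangent space `ℝ^{J-1} × ℝ^{J-1} × ℝ^J × ℝ × 𝓕₀`, with its real vector space structure. -/
abbrev Tangent (K : ℕ) : Type :=
  (Fin K → ℝ) × (Fin K → ℝ) × (Fin (K + 1) → ℝ) × ℝ × F0

namespace Tangent

variable {K : ℕ}

/-- `h_{θ,j}`, `j = 2, …, J`. -/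
abbrev dθ (h : Tangent K) : Fin K → ℝ := h.1

/-- `h_{a,j}`, `j = 2, …, J`. -/
abbrev da (h : Tangent K) : Fin K → ℝ := h.2.1

/-- `h_{υ,j}`, `j = 1, …, J`. -/
abbrev dυ (h : Tangent K) : Fin (K + 1) → ℝ := h.2.2.1

/-- `h_σ`. -/
abbrev dσ (h : Tangent K) : ℝ := h.2.2.2.1

/-- `h_f`. -/
abbrev df (h : Tangent K) : ℝ → ℝ := h.2.2.2.2.1

end Tangent

/-- The inner product `∫₀^{2π} u(t) v(t) dt/(2π)` of `𝕃²[0, 2π]`. -/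
def innerL2 (u v : ℝ → ℝ) : ℝ :=
  (∫ t in (0 : ℝ)..(2 * Real.pi), u t * v t) / (2 * Real.pi)

/-- The unshifted tangent function of each curve:
`a₁ h_f - ∑_{k ≥ 2} h_{a,k} (a_k / a₁) f + h_{υ,1}` for the reference curve and
`a_j h_f + h_{a,j} f - h_{θ,j} a_j ∂f + h_{υ,j}` for the curves `j ≥ 2`. -/
def score {K : ℕ} (α : Param K) (f : F0) (h : Tangent K) (j : Fin (K + 1)) (t : ℝ) : ℝ :=
  Fin.cases (motive := fun _ => ℝ)
    (α.a 0 * h.df t - ∑ k : Fin K, h.da k * (α.a k.succ / α.a 0) * f.1 t + h.dυ 0)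
    (fun k => α.a k.succ * h.df t + h.da k * f.1 t - h.dθ k * α.a k.succ * deriv f.1 t
      + h.dυ k.succ) j

/-- The bilinear form of the tangent space at `(α, f)`; here `J = K + 1`. -/
def tangentForm {K : ℕ} (α : Param K) (f : F0) (h h' : Tangent K) : ℝ :=
  2 * (K + 1 : ℝ) * (h.dσ * h'.dσ) / α.σ ^ 2
    + 1 / α.σ ^ 2 * innerL2 (score α f h 0) (score α f h' 0)
    + 1 / α.σ ^ 2 * ∑ k : Fin K, innerL2 (score α f h k.succ) (score α f h' k.succ)

/-- `A_{i,j}^n(h)`: the tangent function of the `j`-th curve at `t_i - θ_j` (where `θ₁ = 0`). -/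
def coefA {K : ℕ} (n : ℕ) (α : Param K) (f : F0) (h : Tangent K)
    (i : Fin n) (j : Fin (K + 1)) : ℝ :=
  score α f h j (time n i - α.θ j)

/-- The central sequence `Δ_n(h)`, as a function of the observations. -/
def centralSeq {K : ℕ} (n : ℕ) (α : Param K) (f : F0) (h : Tangent K)
    (y : Fin n → Fin (K + 1) → ℝ) : ℝ :=
  1 / √(n : ℝ) * ∑ i : Fin n, ∑ j : Fin (K + 1),
    (h.dσ / α.σ * (noise α f y i j ^ 2 - 1) + coefA n α f h i j * noise α f y i j / α.σ)

/-- The sequence `(α_n, f_n)` approaches `(α, f)` at rate `√n` in the direction `h`. The shifts of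
a `2π`-periodic function matter only modulo `2π`. -/
structure ApproachesAlong {K : ℕ} (α : Param K) (f : F0) (h : Tangent K)
    (αn : ℕ → Param K) (fn : ℕ → F0) : Prop where
  θ_dir : ∃ m : ℕ → Fin K → ℤ, ∀ k : Fin K,
    Tendsto (fun n : ℕ => √(n : ℝ) * ((αn n).θ k.succ + 2 * Real.pi * m n k - α.θ k.succ))
      atTop (𝓝 (h.dθ k))
  a_dir : ∀ k : Fin K,
    Tendsto (fun n : ℕ => √(n : ℝ) * ((αn n).a k.succ - α.a k.succ)) atTop (𝓝 (h.da k))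
  υ_dir : ∀ j : Fin (K + 1),
    Tendsto (fun n : ℕ => √(n : ℝ) * ((αn n).υ j - α.υ j)) atTop (𝓝 (h.dυ j))
  σ_dir : Tendsto (fun n : ℕ => √(n : ℝ) * ((αn n).σ - α.σ)) atTop (𝓝 h.dσ)
  f_dir : TendstoUniformly (fun (n : ℕ) (t : ℝ) => √(n : ℝ) * ((fn n).1 t - f.1 t)) h.df atTop

/-- `R_n = o_ℙ(1)` under the laws `P_n`: convergence to `0` in probability along a sequence of
probability spaces. -/
def IsLittleOP {Ω : ℕ → Type} [∀ n, MeasurableSpace (Ω n)] (P : (n : ℕ) → Measure (Ω n))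
    (R : (n : ℕ) → Ω n → ℝ) : Prop :=
  ∀ δ : ℝ, 0 < δ → Tendsto (fun n => P n {y | δ ≤ |R n y|}) atTop (𝓝 0)

end ShapeInvariant

end

open ShapeInvariant

noncomputable section

namespace ShapeInvariant

variable {K : ℕ}

/-! Everything probabilistic reduces to one object, `quadSum`: a sum of `b (ε² - 1) + c ε` over
independent standard Gaussians. Its characteristic function is explicit (`charFun_quadSum`), so
`tendstoInDistribution_quadSum` gives a Gaussian limit by passing to the limit in an exponent,
without a Lindeberg condition. Only the limits of `√n b` and `∑ c²` matter.

The central sequence is such a form, and Riemann sums (`tendsto_riemann_sum`) identify its limiting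
variance with `tangentForm α f h h`. The Gaussian log-likelihood ratio is also such a form plus a
constant (`logLikRatio_ae_eq`), hence so is the LAN remainder. Its coefficients are asymptotically
negligible, so the same limit theorem, now with variance `0`, makes it `o_P(1)`
(`isLittleOP_logLikRatio_sub`).

This needs the regression functions to move like the tangent functions divided by `√n`, uniformly in
time. An explicit `path` is used: the reference amplitude is forced by the normalization `∑ a_j² =
J`, and differentiating it gives the sum over `k` in the reference tangent function. The expansion
comes from strict differentiability of `f` (`tendstoUniformlyOn_curve_expansion`).

Positive definiteness is identifiability of the tangent functions (`eq_zero_of_score_eq_zero`): zero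
means isolate the levels, orthogonality of `f` and its derivative isolates the shifts, and the
normalization excludes a trade-off between the amplitudes and the shape. -/

theorem F0_continuous (f : F0) : Continuous f.1 := f.2.1

theorem F0_periodic (f : F0) : Function.Periodic f.1 (2 * Real.pi) := f.2.2.1

theorem F0_integral (f : F0) : ∫ t in (0 : ℝ)..(2 * Real.pi), f.1 t = 0 := by
  have h := f.2.2.2
  have hpi : (2 * Real.pi) ≠ 0 := by positivity
  simpa [hpi] using h

theorem periodic_deriv {g : ℝ → ℝ} {c : ℝ} (hg : Function.Periodic g c) :
    Function.Periodic (deriv g) c := fun t => by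
  rw [← deriv_comp_add_const]
  congr 1
  exact funext hg

/-! ### Tangent functions: linearity, continuity, periodicity. -/

theorem score_zero (α : Param K) (f : F0) (h : Tangent K) (t : ℝ) :
    score α f h 0 t
      = α.a 0 * h.df t - ∑ k : Fin K, h.da k * (α.a k.succ / α.a 0) * f.1 t + h.dυ 0 := rfl

theorem score_succ (α : Param K) (f : F0) (h : Tangent K) (k : Fin K) (t : ℝ) :
    score α f h k.succ t
      = α.a k.succ * h.df t + h.da k * f.1 t - h.dθ k * α.a k.succ * deriv f.1 t
        + h.dυ k.succ := rfl

theorem score_add (α : Param K) (f : F0) (h h' : Tangent K) (j : Fin (K + 1)) (t : ℝ) :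
    score α f (h + h') j t = score α f h j t + score α f h' j t := by
  refine Fin.cases ?_ (fun k => ?_) j
  · simp only [score_zero, Tangent.df, Tangent.da, Tangent.dυ, Prod.snd_add, Prod.fst_add,
      Submodule.coe_add, Pi.add_apply, add_mul, Finset.sum_add_distrib]
    ring
  · simp only [score_succ, Tangent.df, Tangent.da, Tangent.dυ, Tangent.dθ, Prod.snd_add,
      Prod.fst_add, Submodule.coe_add, Pi.add_apply]
    ring

theorem score_smul (α : Param K) (f : F0) (c : ℝ) (h : Tangent K) (j : Fin (K + 1)) (t : ℝ) :
    score α f (c • h) j t = c * score α f h j t := by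
  refine Fin.cases ?_ (fun k => ?_) j
  · simp only [score_zero, Tangent.df, Tangent.da, Tangent.dυ, Prod.smul_snd, Prod.smul_fst,
      Submodule.coe_smul, Pi.smul_apply, smul_eq_mul, mul_assoc, ← Finset.mul_sum]
    ring
  · simp only [score_succ, Tangent.df, Tangent.da, Tangent.dυ, Tangent.dθ, Prod.smul_snd,
      Prod.smul_fst, Submodule.coe_smul, Pi.smul_apply, smul_eq_mul]
    ring

theorem continuous_score (α : Param K) (f : F0) (hf : Continuous (deriv f.1)) (h : Tangent K)
    (j : Fin (K + 1)) : Continuous (score α f h j) := by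
  have h1 := F0_continuous f
  have h2 : Continuous h.df := F0_continuous _
  refine Fin.cases ?_ (fun k => ?_) j
  · change Continuous fun t => α.a 0 * h.df t
      - ∑ k : Fin K, h.da k * (α.a k.succ / α.a 0) * f.1 t + h.dυ 0
    fun_prop
  · change Continuous fun t => α.a k.succ * h.df t + h.da k * f.1 t
      - h.dθ k * α.a k.succ * deriv f.1 t + h.dυ k.succ
    fun_prop

theorem periodic_score (α : Param K) (f : F0) (h : Tangent K) (j : Fin (K + 1)) :
    Function.Periodic (score α f h j) (2 * Real.pi) := fun t => by
  have h1 := F0_periodic f t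
  have h2 : h.df (t + 2 * Real.pi) = h.df t := F0_periodic _ t
  have h3 := periodic_deriv (F0_periodic f) t
  refine Fin.cases ?_ (fun k => ?_) j
  · simp only [score_zero, h1, h2]
  · simp only [score_succ, h1, h2, h3]

/-! ### The inner product and its definiteness. -/

theorem tangentForm_eq_sum (α : Param K) (f : F0) (h h' : Tangent K) :
    tangentForm α f h h' = 2 * (K + 1 : ℝ) * (h.dσ * h'.dσ) / α.σ ^ 2
      + 1 / α.σ ^ 2 * ∑ j, innerL2 (score α f h j) (score α f h' j) := by
  rw [tangentForm, Fin.sum_univ_succ]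
  ring

theorem innerL2_comm (u v : ℝ → ℝ) : innerL2 u v = innerL2 v u := by
  simp only [innerL2, mul_comm]

theorem innerL2_add_left {u u' v : ℝ → ℝ} (hu : Continuous u) (hu' : Continuous u')
    (hv : Continuous v) : innerL2 (fun t => u t + u' t) v = innerL2 u v + innerL2 u' v := by
  simp only [innerL2, add_mul]
  rw [intervalIntegral.integral_add ((hu.fun_mul hv).intervalIntegrable _ _)
    ((hu'.fun_mul hv).intervalIntegrable _ _), add_div]

theorem innerL2_smul_left (c : ℝ) (u v : ℝ → ℝ) :
    innerL2 (fun t => c * u t) v = c * innerL2 u v := by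
  simp only [innerL2, mul_assoc]
  rw [intervalIntegral.integral_const_mul, mul_div_assoc]

theorem innerL2_self_nonneg (u : ℝ → ℝ) : 0 ≤ innerL2 u u :=
  div_nonneg (intervalIntegral.integral_nonneg (by positivity) fun t _ => mul_self_nonneg _)
    (by positivity)

theorem eq_zero_of_integral_sq_eq_zero {u : ℝ → ℝ} (hu : Continuous u)
    (hp : Function.Periodic u (2 * Real.pi))
    (h : ∫ t in (0 : ℝ)..(2 * Real.pi), u t * u t = 0) (t : ℝ) : u t = 0 := by
  have hpi : 0 < 2 * Real.pi := by positivity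
  obtain ⟨s, hs, hst⟩ := hp.exists_mem_Ico₀ hpi t
  rw [hst]
  by_contra hne
  exact (intervalIntegral.integral_pos hpi (hu.mul hu).continuousOn
    (fun x _ => mul_self_nonneg _) ⟨s, ⟨hs.1, hs.2.le⟩, mul_self_pos.2 hne⟩).ne' h

theorem eq_zero_of_innerL2_self {u : ℝ → ℝ} (hu : Continuous u)
    (hp : Function.Periodic u (2 * Real.pi)) (h : innerL2 u u = 0) (t : ℝ) : u t = 0 := by
  have hpi : (2 * Real.pi) ≠ 0 := by positivity
  exact eq_zero_of_integral_sq_eq_zero hu hp (by simpa [innerL2, hpi] using h) t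

theorem integral_deriv_periodic {g : ℝ → ℝ} (hp : Function.Periodic g (2 * Real.pi))
    (hd : Differentiable ℝ g) (hc : Continuous (deriv g)) :
    ∫ t in (0 : ℝ)..(2 * Real.pi), deriv g t = 0 := by
  rw [intervalIntegral.integral_deriv_eq_sub (fun x _ => hd x) (hc.intervalIntegrable _ _)]
  simpa using sub_eq_zero.2 (hp 0)

/-- The integrand is the derivative of the periodic function `g² / 2`. This orthogonality prevents a
shift from imitating an amplitude change. -/
theorem integral_mul_deriv_periodic {g : ℝ → ℝ} (hp : Function.Periodic g (2 * Real.pi))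
    (hd : Differentiable ℝ g) (hc : Continuous (deriv g)) :
    ∫ t in (0 : ℝ)..(2 * Real.pi), g t * deriv g t = 0 := by
  have key : ∀ t, HasDerivAt (fun t => g t ^ 2 / 2) (g t * deriv g t) t := fun t => by
    have := ((hd t).hasDerivAt.fun_pow 2).div_const 2
    refine this.congr_deriv ?_
    simp; ring
  rw [intervalIntegral.integral_eq_sub_of_hasDerivAt (fun x _ => key x)
    ((hd.continuous.mul hc).intervalIntegrable _ _)]
  have := hp 0
  simp only [zero_add] at this
  simp [this]

/-- A tangent vector all of whose tangent functions vanish has only a `σ`-component. -/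
theorem eq_zero_of_score_eq_zero {α : Param K} {f : F0} (ha0 : 0 < α.a 0)
    (hf_diff : Differentiable ℝ f.1) (hf_cont : Continuous (deriv f.1))
    (hf_nonconst : ¬ ∃ c : ℝ, ∀ t, f.1 t = c) (ha : ∀ j, α.a j ≠ 0) {h : Tangent K}
    (hσ : h.dσ = 0) (hs : ∀ j t, score α f h j t = 0) : h = 0 := by
  have hpi : 0 < 2 * Real.pi := by positivity
  have hfc := F0_continuous f
  have hgc : Continuous h.df := F0_continuous _
  have hgi : ∫ t in (0 : ℝ)..(2 * Real.pi), h.df t = 0 := F0_integral h.2.2.2.2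
  have hfi := F0_integral f
  have hf'i := integral_deriv_periodic (F0_periodic f) hf_diff hf_cont
  have hff'i := integral_mul_deriv_periodic (F0_periodic f) hf_diff hf_cont
  set c : ℝ := ∑ k : Fin K, h.da k * (α.a k.succ / α.a 0) with hc
  have ii : ∀ {u : ℝ → ℝ}, Continuous u →
    IntervalIntegrable u volume 0 (2 * Real.pi) := fun hu => hu.intervalIntegrable _ _
  -- Integrating over a period kills `h.df`, `f` and `deriv f`, so only the constant survives.
  have mean_zero : ∀ p q r s : ℝ, (∀ t, p * h.df t + q * f.1 t + r * deriv f.1 t + s = 0) →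
      s = 0 := by
    intro p q r s H
    have h0 : ∫ t in (0 : ℝ)..(2 * Real.pi),
        (p * h.df t + q * f.1 t + r * deriv f.1 t + s) = 0 := by simp [H]
    rw [intervalIntegral.integral_add (ii (by fun_prop)) (ii (by fun_prop)),
      intervalIntegral.integral_add (ii (by fun_prop)) (ii (by fun_prop)),
      intervalIntegral.integral_add (ii (by fun_prop)) (ii (by fun_prop)),
      intervalIntegral.integral_const_mul, intervalIntegral.integral_const_mul,
      intervalIntegral.integral_const_mul, hgi, hfi, hf'i] at h0
    simpa [Real.pi_ne_zero] using h0
  have e0 : ∀ t, α.a 0 * h.df t - c * f.1 t + h.dυ 0 = 0 := fun t => by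
    have := hs 0 t
    rw [score_zero, ← Finset.sum_mul] at this
    exact this
  have hυ0 : h.dυ 0 = 0 := mean_zero (α.a 0) (-c) 0 _ fun t => by linarith [e0 t]
  have hdf : ∀ t, h.df t = c / α.a 0 * f.1 t := fun t => by
    have := e0 t
    rw [hυ0] at this
    field_simp
    linarith
  have e1 : ∀ k t, α.a k.succ * h.df t + h.da k * f.1 t
      - h.dθ k * α.a k.succ * deriv f.1 t + h.dυ k.succ = 0 := fun k t => hs k.succ t
  have hυ : ∀ k : Fin K, h.dυ k.succ = 0 := fun k =>
    mean_zero (α.a k.succ) (h.da k) (-(h.dθ k * α.a k.succ)) _ fun t => by linarith [e1 k t]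
  have e2 : ∀ (k : Fin K) t, (α.a k.succ * c / α.a 0 + h.da k) * f.1 t
      = h.dθ k * α.a k.succ * deriv f.1 t := fun k t => by
    have := e1 k t
    rw [hυ, hdf] at this
    linear_combination this
  have hθ : ∀ k, h.dθ k = 0 := fun k => by
    by_contra hne
    have hprod : h.dθ k * α.a k.succ ≠ 0 := mul_ne_zero hne (ha _)
    -- If the shift component were nonzero, `deriv f` would be a multiple of `f`, hence orthogonal
    -- to itself, and `f` would be constant.
    have h0 : ∫ t in (0 : ℝ)..(2 * Real.pi), deriv f.1 t * deriv f.1 t = 0 := by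
      have : ∀ t, deriv f.1 t * deriv f.1 t
          = (α.a k.succ * c / α.a 0 + h.da k) / (h.dθ k * α.a k.succ)
            * (f.1 t * deriv f.1 t) := fun t => by
        have := e2 k t
        rw [div_mul_eq_mul_div, eq_div_iff hprod]
        linear_combination (-deriv f.1 t) * this
      simp only [this]
      rw [intervalIntegral.integral_const_mul, hff'i, mul_zero]
    have hd0 := eq_zero_of_integral_sq_eq_zero hf_cont (periodic_deriv (F0_periodic f)) h0
    exact hf_nonconst ⟨f.1 0, fun t => is_const_of_deriv_eq_zero hf_diff hd0 t 0⟩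
  obtain ⟨t₀, ht₀⟩ : ∃ t, f.1 t ≠ 0 := by
    by_contra! H
    exact hf_nonconst ⟨0, H⟩
  have hda : ∀ k, h.da k = -(α.a k.succ * c / α.a 0) := fun k => by
    have := e2 k t₀
    rw [hθ, zero_mul, zero_mul, mul_eq_zero] at this
    have := this.resolve_right ht₀
    linarith
  -- Substituting `hda` into the definition of `c` gives `(1 + ∑ (a_k / a_0)²) c = 0`, with a
  -- positive factor.
  have hc0 : c = 0 := by
    have h1 : c = -(∑ k : Fin K, (α.a k.succ / α.a 0) ^ 2) * c := by
      conv_lhs => rw [hc]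
      rw [← Finset.sum_neg_distrib, Finset.sum_mul]
      refine Finset.sum_congr rfl fun k _ => ?_
      rw [hda]; ring
    have h2 : (0 : ℝ) ≤ ∑ k : Fin K, (α.a k.succ / α.a 0) ^ 2 :=
      Finset.sum_nonneg fun _ _ => sq_nonneg _
    have h3 : (1 + ∑ k : Fin K, (α.a k.succ / α.a 0) ^ 2) * c = 0 := by linarith
    exact (mul_eq_zero.1 h3).resolve_left (by linarith)
  refine Prod.ext (funext hθ) (Prod.ext (funext fun k => ?_) (Prod.ext ?_ (Prod.ext hσ ?_)))
  · change h.da k = 0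
    rw [hda, hc0]; simp
  · exact funext fun j => Fin.cases hυ0 hυ j
  · exact Subtype.ext (funext fun t => by change h.df t = 0; rw [hdf, hc0]; simp)

theorem exists_tangentForm_core {α : Param K} {f : F0} (hσ : 0 < α.σ) (ha0 : 0 < α.a 0)
    (hf_diff : Differentiable ℝ f.1) (hf_cont : Continuous (deriv f.1))
    (hf_nonconst : ¬ ∃ c : ℝ, ∀ t, f.1 t = c) (ha : ∀ j, α.a j ≠ 0) :
    ∃ c : InnerProductSpace.Core ℝ (Tangent K), ∀ h h', c.inner h h' = tangentForm α f h h' := by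
  refine ⟨{
    inner := tangentForm α f
    conj_inner_symm := ?_
    re_inner_nonneg := ?_
    add_left := ?_
    smul_left := ?_
    definite := ?_ }, fun _ _ => rfl⟩
  · intro h h'
    simp only [conj_trivial, tangentForm_eq_sum, mul_comm, innerL2_comm (score α f h _)]
  · intro h
    have h1 : 0 ≤ ∑ j, innerL2 (score α f h j) (score α f h j) :=
      Finset.sum_nonneg fun _ _ => innerL2_self_nonneg _
    have h2 := mul_self_nonneg h.dσ
    simp only [RCLike.re_to_real, tangentForm_eq_sum]
    positivity
  · intro h h' g
    have hc := fun h : Tangent K => continuous_score α f hf_cont h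
    have : ∀ j, innerL2 (score α f (h + h') j) (score α f g j)
        = innerL2 (score α f h j) (score α f g j) + innerL2 (score α f h' j) (score α f g j) :=
      fun j => by
        rw [← innerL2_add_left (hc _ _) (hc _ _) (hc _ _)]
        congr 1
        exact funext fun t => score_add α f h h' j t
    simp only [tangentForm_eq_sum, this, Finset.sum_add_distrib, Tangent.dσ, Prod.snd_add,
      Prod.fst_add]
    ring
  · intro h g r
    have : ∀ j, innerL2 (score α f (r • h) j) (score α f g j)
        = r * innerL2 (score α f h j) (score α f g j) := fun j => by
      rw [← innerL2_smul_left]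
      congr 1
      exact funext fun t => score_smul α f r h j t
    simp only [tangentForm_eq_sum, this, ← Finset.mul_sum, Tangent.dσ, Prod.smul_snd,
      Prod.smul_fst, conj_trivial, smul_eq_mul]
    ring
  · intro h hh
    have h1 : ∀ j ∈ Finset.univ, 0 ≤ innerL2 (score α f h j) (score α f h j) :=
      fun _ _ => innerL2_self_nonneg _
    have h2 := mul_self_nonneg h.dσ
    have hs := Finset.sum_nonneg h1
    change tangentForm α f h h = 0 at hh
    rw [tangentForm_eq_sum, add_eq_zero_iff_of_nonneg (by positivity) (by positivity)] at hh
    have hdσ : h.dσ = 0 := by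
      have hK : (K + 1 : ℝ) ≠ 0 := by positivity
      simpa [hσ.ne', hK] using hh.1
    have hsum : ∑ j, innerL2 (score α f h j) (score α f h j) = 0 := by
      simpa [hσ.ne'] using hh.2
    rw [Finset.sum_eq_zero_iff_of_nonneg h1] at hsum
    exact eq_zero_of_score_eq_zero ha0 hf_diff hf_cont hf_nonconst ha hdσ fun j =>
      eq_zero_of_innerL2_self (continuous_score α f hf_cont h j) (periodic_score α f h j)
        (hsum j (Finset.mem_univ _))

theorem isLinearMap_centralSeq (n : ℕ) (α : Param K) (f : F0) (y : Fin n → Fin (K + 1) → ℝ) :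
    IsLinearMap ℝ (fun h : Tangent K => centralSeq n α f h y) where
  map_add h h' := by
    simp only [centralSeq, coefA, score_add, ← mul_add, ← Finset.sum_add_distrib, Tangent.dσ,
      Prod.snd_add, Prod.fst_add]
    congr 1
    exact Finset.sum_congr rfl fun i _ => Finset.sum_congr rfl fun j _ => by ring
  map_smul r h := by
    simp only [centralSeq, coefA, score_smul, Tangent.dσ, Prod.smul_snd, Prod.smul_fst,
      smul_eq_mul]
    rw [mul_left_comm]
    congr 1
    simp only [Finset.mul_sum]
    exact Finset.sum_congr rfl fun i _ => Finset.sum_congr rfl fun j _ => by ring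

/-! ### Riemann sums over the observation times. -/

/-- Left-endpoint Riemann sums of a continuous function on a circle converge to its mean. -/
theorem tendsto_riemann_sum {g : ℝ → ℝ} (hg : Continuous g)
    (hp : Function.Periodic g (2 * Real.pi)) (θ : ℝ) :
    Tendsto (fun n : ℕ => (n : ℝ)⁻¹ * ∑ i : Fin n, g (time n i - θ)) atTop
      (𝓝 ((∫ t in (0 : ℝ)..(2 * Real.pi), g t) / (2 * Real.pi))) := by
  have hpi : 0 < 2 * Real.pi := by positivity
  set G : ℝ → ℝ := fun t => g (t - θ) with hG
  have hGc : Continuous G := by fun_prop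
  have hint : ∫ t in (0 : ℝ)..(2 * Real.pi), g t = ∫ t in (0 : ℝ)..(2 * Real.pi), G t := by
    rw [hG, intervalIntegral.integral_comp_sub_right (fun t => g t) θ]
    have := hp.intervalIntegral_add_eq 0 (0 - θ)
    rw [zero_add] at this
    rw [this]
    congr 1; ring
  rw [hint]
  have huc : UniformContinuousOn G (Set.Icc 0 (2 * Real.pi)) :=
    isCompact_Icc.uniformContinuousOn_of_continuous hGc.continuousOn
  rw [Metric.tendsto_atTop]
  intro ε hε
  rw [Metric.uniformContinuousOn_iff] at huc
  obtain ⟨δ, hδ, H⟩ := huc (ε / 2) (by positivity)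
  obtain ⟨N, hN⟩ := exists_nat_gt (2 * Real.pi / δ)
  refine ⟨N + 1, fun n hn => ?_⟩
  have hn0 : (0 : ℝ) < n := by exact_mod_cast (by omega : 0 < n)
  have hNn : (N : ℝ) < n := by exact_mod_cast (by omega : N < n)
  have hstep : 2 * Real.pi / n < δ := by
    rw [div_lt_iff₀ hn0, mul_comm δ]
    exact (div_lt_iff₀ hδ).1 (hN.trans hNn)
  set T : ℕ → ℝ := fun i => (i : ℝ) / n * (2 * Real.pi) with hT
  have hTs : ∀ i, T (i + 1) - T i = 2 * Real.pi / n := fun i => by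
    simp only [hT]; push_cast; field_simp; ring
  have hsplit : ∫ t in (0 : ℝ)..(2 * Real.pi), G t
      = ∑ i ∈ Finset.range n, ∫ t in T i..T (i + 1), G t := by
    rw [intervalIntegral.sum_integral_adjacent_intervals
      (fun _ _ => hGc.intervalIntegrable _ _)]
    simp [hT, hn0.ne']
  -- The Riemann sum is the integral of a step function, to be compared with `G` cell by cell; the
  -- mesh is below the modulus `δ`.
  have hsum : (n : ℝ)⁻¹ * ∑ i : Fin n, g (time n i - θ)
      = (∑ i ∈ Finset.range n, ∫ _ in T i..T (i + 1), G (T i)) / (2 * Real.pi) := by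
    rw [Finset.sum_range]
    simp only [intervalIntegral.integral_const, hTs, smul_eq_mul, ← Finset.mul_sum]
    rw [mul_comm (2 * Real.pi / n), mul_div_assoc, div_div_cancel_left' hpi.ne', mul_comm]
    rfl
  rw [hsum, hsplit, dist_eq_norm, ← sub_div, ← Finset.sum_sub_distrib, norm_div,
    Real.norm_of_nonneg hpi.le, div_lt_iff₀ hpi]
  have hb : ∀ i ∈ Finset.range n,
      ‖(∫ _ in T i..T (i + 1), G (T i)) - ∫ t in T i..T (i + 1), G t‖
        ≤ ε / 2 * (2 * Real.pi / n) := fun i hi => by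
    have hTm : ∀ k ≤ n, T k ∈ Set.Icc 0 (2 * Real.pi) := fun k hk => by
      have : (k : ℝ) / n ≤ 1 := by rw [div_le_one hn0]; exact_mod_cast hk
      exact ⟨by positivity, by nlinarith⟩
    have hin := Finset.mem_range.1 hi
    have hle : T i ≤ T (i + 1) := by
      have := hTs i
      have : 0 < 2 * Real.pi / n := by positivity
      linarith
    rw [← intervalIntegral.integral_sub (by simp) (hGc.intervalIntegrable _ _)]
    have := intervalIntegral.norm_integral_le_of_norm_le_const
      (a := T i) (b := T (i + 1)) (C := ε / 2) (f := fun t => G (T i) - G t) fun t ht => by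
        rw [Set.uIoc_of_le hle] at ht
        rw [← dist_eq_norm]
        refine (H _ (hTm i hin.le) t ⟨(hTm i hin.le).1.trans ht.1.le,
          ht.2.trans (hTm (i + 1) hin).2⟩ ?_).le
        rw [dist_comm, Real.dist_eq, abs_of_pos (by linarith [ht.1])]
        linarith [ht.2, hTs i]
    rwa [hTs, abs_of_pos (by positivity)] at this
  refine (norm_sum_le_of_le _ hb).trans_lt ?_
  rw [Finset.sum_const, Finset.card_range, nsmul_eq_mul]
  have : (n : ℝ) * (ε / 2 * (2 * Real.pi / n)) = ε / 2 * (2 * Real.pi) := by field_simp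
  rw [this]
  nlinarith

/-! ### Limit law of quadratic forms in Gaussian noise. -/

/-- A quadratic-plus-linear form in the noise, with constant quadratic coefficient. -/
def quadSum {n : ℕ} (α : Param K) (f : F0) (b : ℝ) (c : Fin n → Fin (K + 1) → ℝ)
    (y : Fin n → Fin (K + 1) → ℝ) : ℝ :=
  ∑ i, ∑ j, (b * (noise α f y i j ^ 2 - 1) + c i j * noise α f y i j)

theorem measurable_noise {n : ℕ} (α : Param K) (f : F0) (i : Fin n) (j : Fin (K + 1)) :
    Measurable fun y : Fin n → Fin (K + 1) → ℝ => noise α f y i j := by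
  unfold noise
  fun_prop

theorem measurable_quadSum {n : ℕ} (α : Param K) (f : F0) (b : ℝ)
    (c : Fin n → Fin (K + 1) → ℝ) : Measurable (quadSum α f b c) := by
  have := fun (i : Fin n) (j : Fin (K + 1)) => measurable_noise α f i j
  unfold quadSum
  fun_prop

theorem integral_gaussianReal_standardize {m σ : ℝ} (hσ : 0 < σ) {g : ℝ → ℂ}
    (hg : Continuous g) :
    ∫ x, g ((x - m) / σ) ∂gaussianReal m (Real.toNNReal (σ ^ 2))
      = ∫ x, g x ∂gaussianReal 0 1 := by
  have hmap : (gaussianReal m (Real.toNNReal (σ ^ 2))).map (fun x => (x - m) / σ)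
      = gaussianReal 0 1 := by
    rw [show (fun x => (x - m) / σ) = (fun x => x / σ) ∘ (fun x => x - m) from rfl,
      ← Measure.map_map (by fun_prop) (by fun_prop), gaussianReal_map_sub_const,
      gaussianReal_map_div_const]
    congr 1
    · simp
    · ext
      simp [Real.coe_toNNReal _ (sq_nonneg σ), hσ.ne']
  rw [← hmap, integral_map (by fun_prop) hg.aestronglyMeasurable]

theorem integral_prod_noise {n : ℕ} {α : Param K} (hσ : 0 < α.σ) (f : F0)
    {g : Fin n → Fin (K + 1) → ℝ → ℂ} (hg : ∀ i j, Continuous (g i j)) :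
    ∫ y, ∏ i, ∏ j, g i j (noise α f y i j) ∂obsLaw n α f
      = ∏ i, ∏ j, ∫ x, g i j x ∂gaussianReal 0 1 := by
  unfold obsLaw noise
  rw [integral_fintype_prod_eq_prod
    (f := fun i (z : Fin (K + 1) → ℝ) => ∏ j, g i j ((z j - mean α f (time n i) j) / α.σ))]
  refine Finset.prod_congr rfl fun i _ => ?_
  unfold pointLaw
  rw [integral_fintype_prod_eq_prod
    (f := fun j (x : ℝ) => g i j ((x - mean α f (time n i) j) / α.σ))]
  exact Finset.prod_congr rfl fun j _ => integral_gaussianReal_standardize hσ (hg i j)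

/-- The Laplace–Fourier transform of a quadratic polynomial in a standard Gaussian. -/
theorem integral_cexp_quadratic_gaussianReal {z : ℂ} (hz : z.re < 1 / 2) (w d : ℂ) :
    ∫ x : ℝ, Complex.exp (z * x ^ 2 + w * x + d) ∂gaussianReal 0 1
      = Complex.exp (-(1 / 2) * Complex.log (1 - 2 * z) + d + w ^ 2 / (2 * (1 - 2 * z))) := by
  have hre : 0 < (1 - 2 * z).re := by simp; linarith
  have hne : 1 - 2 * z ≠ 0 := fun h => by simp [h] at hre
  have hpi : (0 : ℝ) < 2 * Real.pi := by positivity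
  have hpi' : ((2 * Real.pi : ℝ) : ℂ) ≠ 0 := by exact_mod_cast hpi.ne'
  rw [integral_gaussianReal_eq_integral_smul one_ne_zero]
  have hpt : ∀ x : ℝ, gaussianPDFReal 0 1 x • Complex.exp (z * x ^ 2 + w * x + d)
      = Complex.exp (-(1 / 2) * Complex.log ((2 * Real.pi : ℝ) : ℂ))
        * Complex.exp ((z - 1 / 2) * x ^ 2 + w * x + d) := fun x => by
    rw [gaussianPDFReal_def, Complex.real_smul, Complex.ofReal_mul, Complex.ofReal_exp, mul_assoc,
      ← Complex.exp_add]
    congr 1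
    · have : (√(2 * Real.pi * (1 : NNReal)))⁻¹
          = Real.exp (-(1 / 2) * Real.log (2 * Real.pi)) := by
        rw [NNReal.coe_one, mul_one, neg_mul, Real.exp_neg, mul_comm (1 / 2), Real.exp_mul,
          Real.exp_log hpi, Real.sqrt_eq_rpow]
      rw [this, Complex.ofReal_exp, ← Complex.ofReal_log hpi.le]
      push_cast
      rfl
    · congr 1
      push_cast
      ring
  simp only [hpt]
  rw [integral_const_mul, integral_cexp_quadratic (by simp; linarith)]
  have hquot : (Real.pi : ℂ) / -(z - 1 / 2) = ((2 * Real.pi : ℝ) : ℂ) * (1 - 2 * z)⁻¹ := by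
    have : -(z - 1 / 2) = (1 - 2 * z) / 2 := by ring
    rw [this]
    push_cast
    field_simp
  -- The positive real part keeps `1 - 2 z` off the branch cut, so the principal logarithm of its
  -- inverse is minus its logarithm.
  have harg : (1 - 2 * z).arg ≠ Real.pi := by
    rw [Ne, Complex.arg_eq_pi_iff, not_and_or, not_lt]
    exact Or.inl hre.le
  rw [hquot, Complex.cpow_def_of_ne_zero (mul_ne_zero hpi' (inv_ne_zero hne)),
    Complex.log_ofReal_mul hpi (inv_ne_zero hne), Complex.log_inv _ harg, ← Complex.exp_add,
    ← Complex.exp_add, Complex.ofReal_log hpi.le]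
  congr 1
  have h4 : 4 * (z - 1 / 2) = -(2 * (1 - 2 * z)) := by ring
  rw [h4, div_neg]
  ring

/-- By independence the transform is a product of one-dimensional ones. Since `b` is common to all
terms, the logarithms coincide, and `c` enters only through its sum of squares. -/
theorem charFun_quadSum {n : ℕ} {α : Param K} (hσ : 0 < α.σ) (f : F0) (b κ : ℝ)
    (c : Fin n → Fin (K + 1) → ℝ) (s : ℝ) :
    charFun ((obsLaw n α f).map fun y => quadSum α f b c y + κ) s
      = Complex.exp (n * (K + 1) * (-(1 / 2) * Complex.log (1 - 2 * (s * b * Complex.I))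
          - s * b * Complex.I)
        - s ^ 2 * (∑ i, ∑ j, c i j ^ 2 : ℝ) / (2 * (1 - 2 * (s * b * Complex.I)))
        + s * κ * Complex.I) := by
  rw [charFun_apply_real, integral_map ((measurable_quadSum α f b c).add_const κ).aemeasurable
    (by fun_prop)]
  obtain ⟨g, hg⟩ : ∃ g : Fin n → Fin (K + 1) → ℝ → ℂ, ∀ i j x, g i j x =
      Complex.exp ((s * b * Complex.I) * x ^ 2 + (s * c i j * Complex.I) * x
        + -(s * b * Complex.I)) := ⟨_, fun _ _ _ => rfl⟩
  have hgc : ∀ i j, Continuous (g i j) := fun i j => by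
    rw [funext (hg i j)]
    fun_prop
  have hpt : ∀ y : Fin n → Fin (K + 1) → ℝ,
      Complex.exp (s * (quadSum α f b c y + κ : ℝ) * Complex.I)
      = Complex.exp (s * κ * Complex.I) * ∏ i, ∏ j, g i j (noise α f y i j) := fun y => by
    simp only [hg, ← Complex.exp_sum]
    rw [← Complex.exp_add]
    congr 1
    unfold quadSum
    push_cast
    rw [mul_add, add_mul, add_comm]
    congr 1
    simp only [Finset.mul_sum, Finset.sum_mul]
    exact Finset.sum_congr rfl fun i _ => Finset.sum_congr rfl fun j _ => by ring
  rw [integral_congr_ae (ae_of_all _ hpt), integral_const_mul,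
    integral_prod_noise hσ f hgc]
  simp only [hg, integral_cexp_quadratic_gaussianReal (z := s * b * Complex.I) (by simp),
    ← Complex.exp_sum]
  rw [← Complex.exp_add]
  congr 1
  have hsq : ∀ i j, ((s : ℂ) * c i j * Complex.I) ^ 2 = -(s ^ 2 * c i j ^ 2) := fun i j => by
    rw [mul_pow, Complex.I_sq]; ring
  simp only [hsq, Finset.sum_add_distrib, Finset.sum_const, Finset.card_univ, Fintype.card_fin,
    nsmul_eq_mul, ← Finset.sum_div, Finset.sum_neg_distrib, ← Finset.mul_sum]
  push_cast
  ring

theorem log_one_sub_two_mul_isLittleO :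
    (fun z : ℂ => -(1 / 2) * Complex.log (1 - 2 * z) - z - z ^ 2)
      =o[𝓝 0] fun z => z ^ 2 := by
  have h0 : Tendsto (fun z : ℂ => -2 * z) (𝓝 0) (𝓝 0) := by
    have : Continuous fun z : ℂ => -2 * z := by fun_prop
    simpa using this.tendsto 0
  have h1 := (Complex.log_sub_logTaylor_isBigO 2).comp_tendsto h0
  have h2 : (fun z : ℂ => -(1 / 2) * Complex.log (1 - 2 * z) - z - z ^ 2)
      =O[𝓝 0] fun z : ℂ => z ^ 3 := by
    refine ((h1.const_mul_left (-(1 / 2))).trans ?_).congr_left fun z => ?_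
    · have : ((fun z : ℂ => z ^ (2 + 1)) ∘ fun z => -2 * z) = fun z => (-8) * z ^ 3 := by
        funext z; simp only [Function.comp]; ring
      rw [this]
      exact Asymptotics.isBigO_const_mul_self _ _ _
    · simp only [Function.comp, Complex.logTaylor_succ, Complex.logTaylor_zero, Pi.add_apply]
      push_cast
      rw [show (1 : ℂ) - 2 * z = 1 + -2 * z by ring]
      simp
      ring
  exact h2.trans_isLittleO (Asymptotics.isLittleO_pow_pow (by norm_num))

/-- With `z = i s b`, centring by `-1` cancels the first-order term of `-(1/2) log (1 - 2 z) = z +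
z² + o(z²)`. What remains is `n z²`, which tends to `-s² β²`. -/
theorem tendsto_charFun_exponent {b κ V : ℕ → ℝ} {β κ' V' : ℝ}
    (hb : Tendsto (fun n : ℕ => √(n : ℝ) * b n) atTop (𝓝 β)) (hV : Tendsto V atTop (𝓝 V'))
    (hκ : Tendsto κ atTop (𝓝 κ')) (K : ℕ) (s : ℝ) :
    Tendsto (fun n : ℕ => (n : ℂ) * (K + 1) * (-(1 / 2) * Complex.log (1 - 2 * (s * b n * Complex.I))
          - s * b n * Complex.I)
        - s ^ 2 * (V n : ℝ) / (2 * (1 - 2 * (s * b n * Complex.I))) + s * κ n * Complex.I)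
      atTop (𝓝 (-((K : ℂ) + 1) * s ^ 2 * β ^ 2 - s ^ 2 * V' / 2 + s * κ' * Complex.I)) := by
  have hsqrt : Tendsto (fun n : ℕ => (√(n : ℝ))⁻¹) atTop (𝓝 0) :=
    tendsto_inv_atTop_zero.comp (Real.tendsto_sqrt_atTop.comp tendsto_natCast_atTop_atTop)
  have hb0 : Tendsto b atTop (𝓝 0) := by
    have := hsqrt.mul hb
    rw [zero_mul] at this
    refine this.congr' ?_
    filter_upwards [eventually_gt_atTop 0] with n hn
    have : √(n : ℝ) ≠ 0 := by positivity
    field_simp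
  have hz0 : Tendsto (fun n => (s : ℂ) * b n * Complex.I) atTop (𝓝 0) := by
    have := ((Complex.continuous_ofReal.tendsto 0).comp hb0).const_mul (s : ℂ)
      |>.mul_const Complex.I
    simpa using this
  have hnz : Tendsto (fun n : ℕ => (n : ℂ) * ((s : ℂ) * b n * Complex.I) ^ 2) atTop
      (𝓝 (-(s ^ 2 * β ^ 2))) := by
    have := (((Complex.continuous_ofReal.tendsto β).comp hb).pow 2).const_mul (-(s : ℂ) ^ 2)
    rw [neg_mul] at this
    refine this.congr fun n => ?_
    have hn : ((√(n : ℝ) : ℝ) : ℂ) ^ 2 = n := by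
      rw [← Complex.ofReal_pow, Real.sq_sqrt (Nat.cast_nonneg n)]
      simp
    simp only [Function.comp, Complex.ofReal_mul]
    rw [mul_pow, mul_pow, mul_pow, hn, Complex.I_sq]
    ring
  -- The remainder is `n · o(z²)` and `n z²` is bounded because it converges.
  have hrem : Tendsto (fun n : ℕ => (n : ℂ) * (-(1 / 2)
      * Complex.log (1 - 2 * ((s : ℂ) * b n * Complex.I)) - (s : ℂ) * b n * Complex.I
      - ((s : ℂ) * b n * Complex.I) ^ 2)) atTop (𝓝 0) := by
    have h1 := log_one_sub_two_mul_isLittleO.comp_tendsto hz0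
    have h2 := (Asymptotics.isBigO_refl (fun n : ℕ => (n : ℂ)) atTop).mul_isLittleO h1
    exact (h2.trans_isBigO (hnz.isBigO_one ℂ)).tendsto_zero_of_tendsto tendsto_const_nhds
  have hVt : Tendsto (fun n => s ^ 2 * (V n : ℂ) / (2 * (1 - 2 * (s * b n * Complex.I)))) atTop
      (𝓝 ((s : ℂ) ^ 2 * V' / 2)) := by
    have h1 : Tendsto (fun n => 2 * (1 - 2 * ((s : ℂ) * b n * Complex.I))) atTop (𝓝 2) := by
      simpa using ((hz0.const_mul 2).const_sub 1).const_mul 2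
    exact (((Complex.continuous_ofReal.tendsto V').comp hV).const_mul _).div h1 two_ne_zero
  have hκt := ((Complex.continuous_ofReal.tendsto κ').comp hκ).const_mul (s : ℂ)
      |>.mul_const Complex.I
  have := (((hrem.add hnz).mul_const ((K : ℂ) + 1)).sub hVt).add hκt
  convert! this using 2
  · simp only [Function.comp]; ring
  · ring

/-- Asymptotic normality of quadratic-plus-linear forms in the noise. -/
theorem tendstoInDistribution_quadSum {α : Param K} (hσ : 0 < α.σ) (f : F0)
    {b κ : ℕ → ℝ} {c : (n : ℕ) → Fin n → Fin (K + 1) → ℝ} {β κ' V : ℝ}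
    (hb : Tendsto (fun n : ℕ => √(n : ℝ) * b n) atTop (𝓝 β))
    (hc : Tendsto (fun n : ℕ => ∑ i, ∑ j, c n i j ^ 2) atTop (𝓝 V))
    (hκ : Tendsto κ atTop (𝓝 κ')) :
    TendstoInDistribution (fun (n : ℕ) y => quadSum α f (b n) (c n) y + κ n) atTop (id : ℝ → ℝ)
      (fun n : ℕ => obsLaw n α f)
      (gaussianReal κ' (Real.toNNReal (2 * (K + 1) * β ^ 2 + V))) where
  forall_aemeasurable n := ((measurable_quadSum α f (b n) (c n)).add_const (κ n)).aemeasurable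
  aemeasurable_limit := aemeasurable_id
  tendsto := by
    have hV : 0 ≤ V := ge_of_tendsto' hc fun n =>
      Finset.sum_nonneg fun _ _ => Finset.sum_nonneg fun _ _ => sq_nonneg _
    refine ProbabilityMeasure.tendsto_iff_tendsto_charFun.2 fun s => ?_
    simp only [ProbabilityMeasure.coe_mk, Measure.map_id, charFun_gaussianReal,
      charFun_quadSum hσ]
    refine (Complex.continuous_exp.tendsto _).comp ?_
    convert! tendsto_charFun_exponent hb hc hκ K s using 2
    rw [Real.coe_toNNReal _ (by positivity)]
    push_cast
    ring

/-! ### The Gaussian likelihood ratio. -/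

/-- It suffices to compare on boxes, where the indicator splits into a product and the integral
factorizes by independence of the coordinates. -/
theorem pi_withDensity {ι : Type*} [Fintype ι] {X : ι → Type*} [∀ i, MeasurableSpace (X i)]
    (μ : (i : ι) → Measure (X i)) [∀ i, IsProbabilityMeasure (μ i)]
    {f : (i : ι) → X i → ENNReal} (hf : ∀ i, Measurable (f i))
    [∀ i, IsProbabilityMeasure ((μ i).withDensity (f i))] :
    Measure.pi (fun i => (μ i).withDensity (f i))
      = (Measure.pi μ).withDensity (fun x => ∏ i, f i (x i)) := by
  refine Measure.pi_eq fun s hs => ?_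
  have hfs : ∀ i, Measurable ((s i).indicator (f i)) := fun i => (hf i).indicator (hs i)
  rw [withDensity_apply _ (.univ_pi hs), ← lintegral_indicator (.univ_pi hs)]
  have hind : (Set.univ.pi s).indicator (fun x : (i : ι) → X i => ∏ i, f i (x i))
      = fun x => ∏ i, (s i).indicator (f i) (x i) := by
    funext x
    by_cases hx : x ∈ Set.univ.pi s
    · rw [Set.indicator_of_mem hx]
      exact Finset.prod_congr rfl fun i _ => (Set.indicator_of_mem (hx i trivial) _).symm
    · rw [Set.indicator_of_notMem hx]
      simp only [Set.mem_pi, Set.mem_univ, true_imp_iff, not_forall] at hx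
      obtain ⟨i, hi⟩ := hx
      exact (Finset.prod_eq_zero (Finset.mem_univ i) (Set.indicator_of_notMem hi _)).symm
  have hindep : iIndepFun (fun i (x : (i : ι) → X i) => (s i).indicator (f i) (x i))
      (Measure.pi μ) := iIndepFun_pi fun i => (hfs i).aemeasurable
  rw [hind, lintegral_prod_eq_prod_lintegral_of_indepFun Finset.univ _ hindep
    fun i => (hfs i).comp (measurable_pi_apply i)]
  refine Finset.prod_congr rfl fun i _ => ?_
  rw [(measurePreserving_eval μ i).lintegral_comp (hfs i), lintegral_indicator (hs i),
    withDensity_apply _ (hs i)]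

/-- The log-likelihood ratio of two Gaussian laws, as a polynomial in the standardized variable
of the reference law. -/
def gaussianLogRatio (m σ m' σ' x : ℝ) : ℝ :=
  Real.log (σ / σ') + (1 - σ ^ 2 / σ' ^ 2) / 2 * ((x - m) / σ) ^ 2
    + σ * (m' - m) / σ' ^ 2 * ((x - m) / σ) - (m' - m) ^ 2 / (2 * σ' ^ 2)

theorem gaussianReal_eq_withDensity {m σ m' σ' : ℝ} (hσ : 0 < σ) (hσ' : 0 < σ') :
    gaussianReal m' (Real.toNNReal (σ' ^ 2)) = (gaussianReal m (Real.toNNReal (σ ^ 2))).withDensity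
      fun x => ENNReal.ofReal (Real.exp (gaussianLogRatio m σ m' σ' x)) := by
  have hv : ∀ {s : ℝ}, 0 < s → Real.toNNReal (s ^ 2) ≠ 0 := fun hs => by
    rw [Ne, Real.toNNReal_eq_zero, not_le]
    positivity
  have hm : Measurable fun x => ENNReal.ofReal (Real.exp (gaussianLogRatio m σ m' σ' x)) := by
    unfold gaussianLogRatio
    fun_prop
  rw [gaussianReal_of_var_ne_zero _ (hv hσ), gaussianReal_of_var_ne_zero _ (hv hσ'),
    ← withDensity_mul _ (measurable_gaussianPDF _ _) hm]
  congr 1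
  funext x
  rw [Pi.mul_apply, gaussianPDF, gaussianPDF, ← ENNReal.ofReal_mul (gaussianPDFReal_nonneg _ _ _)]
  congr 1
  have hs : ∀ {s : ℝ}, 0 < s → (√(2 * Real.pi * s ^ 2))⁻¹ = (√(2 * Real.pi))⁻¹ * s⁻¹ :=
    fun {s} h => by
      rw [Real.sqrt_mul (by positivity), Real.sqrt_sq h.le, mul_inv]
  simp only [gaussianPDFReal_def, Real.coe_toNNReal _ (sq_nonneg σ),
    Real.coe_toNNReal _ (sq_nonneg σ'), hs hσ, hs hσ', gaussianLogRatio]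
  have hexp : Real.log (σ / σ') + (1 - σ ^ 2 / σ' ^ 2) / 2 * ((x - m) / σ) ^ 2
    + σ * (m' - m) / σ' ^ 2 * ((x - m) / σ) - (m' - m) ^ 2 / (2 * σ' ^ 2)
      = Real.log (σ / σ') + ((x - m) ^ 2 / (2 * σ ^ 2) + -(x - m') ^ 2 / (2 * σ' ^ 2)) := by
    field_simp
    ring
  rw [hexp, Real.exp_add, Real.exp_log (by positivity), Real.exp_add, neg_div, Real.exp_neg]
  field_simp
  rw [← Real.exp_add]
  simp

theorem pointLaw_eq_withDensity {α α' : Param K} (hσ : 0 < α.σ) (hσ' : 0 < α'.σ) (f f' : F0)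
    (t : ℝ) :
    pointLaw α' f' t = (pointLaw α f t).withDensity fun z => ENNReal.ofReal (Real.exp
      (∑ j, gaussianLogRatio (mean α f t j) α.σ (mean α' f' t j) α'.σ (z j))) := by
  have heq := fun j => gaussianReal_eq_withDensity (m := mean α f t j) (m' := mean α' f' t j) hσ hσ'
  have hp : ∀ j, IsProbabilityMeasure
      ((gaussianReal (mean α f t j) (Real.toNNReal (α.σ ^ 2))).withDensity fun x =>
        ENNReal.ofReal (Real.exp
          (gaussianLogRatio (mean α f t j) α.σ (mean α' f' t j) α'.σ x))) := fun j => by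
    rw [← heq]
    infer_instance
  unfold pointLaw
  rw [funext heq, pi_withDensity _ fun j => by unfold gaussianLogRatio; fun_prop]
  congr 1
  funext z
  rw [Real.exp_sum, ENNReal.ofReal_prod_of_nonneg fun _ _ => (Real.exp_pos _).le]

theorem obsLaw_eq_withDensity {α α' : Param K} (hσ : 0 < α.σ) (hσ' : 0 < α'.σ) (f f' : F0)
    (n : ℕ) :
    obsLaw n α' f' = (obsLaw n α f).withDensity fun y => ENNReal.ofReal (Real.exp
      (∑ i, ∑ j, gaussianLogRatio (mean α f (time n i) j) α.σ (mean α' f' (time n i) j) α'.σ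
        (y i j))) := by
  have heq := fun i : Fin n => pointLaw_eq_withDensity hσ hσ' f f' (time n i)
  have hp : ∀ i : Fin n, IsProbabilityMeasure
      ((pointLaw α f (time n i)).withDensity fun z => ENNReal.ofReal (Real.exp
        (∑ j, gaussianLogRatio (mean α f (time n i) j) α.σ (mean α' f' (time n i) j) α'.σ
          (z j)))) := fun i => by
    rw [← heq]
    infer_instance
  unfold obsLaw
  rw [funext heq, pi_withDensity _ fun i => by unfold gaussianLogRatio; fun_prop]
  congr 1
  funext y
  rw [Real.exp_sum, ENNReal.ofReal_prod_of_nonneg fun _ _ => (Real.exp_pos _).le]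

/-- The log-likelihood ratio is a quadratic-plus-linear form in the noise. -/
theorem logLikRatio_ae_eq {α α' : Param K} (hσ : 0 < α.σ) (hσ' : 0 < α'.σ) (f f' : F0) (n : ℕ) :
    logLikRatio n α f α' f' =ᵐ[obsLaw n α f] fun y =>
      quadSum α f ((1 - α.σ ^ 2 / α'.σ ^ 2) / 2)
        (fun i j => α.σ * (mean α' f' (time n i) j - mean α f (time n i) j) / α'.σ ^ 2) y
      + (n * (K + 1) * (Real.log (α.σ / α'.σ) + (1 - α.σ ^ 2 / α'.σ ^ 2) / 2)
        - ∑ i : Fin n, ∑ j, (mean α' f' (time n i) j - mean α f (time n i) j) ^ 2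
          / (2 * α'.σ ^ 2)) := by
  have hd : Measurable fun y : Fin n → Fin (K + 1) → ℝ => ENNReal.ofReal (Real.exp
      (∑ i, ∑ j, gaussianLogRatio (mean α f (time n i) j) α.σ (mean α' f' (time n i) j) α'.σ
        (y i j))) := by
    unfold gaussianLogRatio
    fun_prop
  unfold logLikRatio llr
  rw [obsLaw_eq_withDensity hσ hσ' f f' n]
  filter_upwards [Measure.rnDeriv_withDensity (obsLaw n α f) hd] with y hy
  rw [hy, ENNReal.toReal_ofReal (Real.exp_pos _).le, Real.log_exp]
  have hconst : (n : ℝ) * (K + 1) * (Real.log (α.σ / α'.σ) + (1 - α.σ ^ 2 / α'.σ ^ 2) / 2)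
      = ∑ _i : Fin n, ∑ _j : Fin (K + 1),
        (Real.log (α.σ / α'.σ) + (1 - α.σ ^ 2 / α'.σ ^ 2) / 2) := by
    simp
    ring
  rw [hconst]
  simp only [quadSum, ← Finset.sum_sub_distrib, ← Finset.sum_add_distrib]
  refine Finset.sum_congr rfl fun i _ => Finset.sum_congr rfl fun j _ => ?_
  unfold gaussianLogRatio noise
  ring

/-! ### Averages over the design, asymptotic normality and the LAN remainder. -/

theorem tendsto_inv_sqrt_natCast : Tendsto (fun n : ℕ => (√(n : ℝ))⁻¹) atTop (𝓝 0) :=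
  tendsto_inv_atTop_zero.comp (Real.tendsto_sqrt_atTop.comp tendsto_natCast_atTop_atTop)

theorem eventually_sqrt_natCast_pos : ∀ᶠ n : ℕ in atTop, 0 < √(n : ℝ) := by
  filter_upwards [eventually_gt_atTop 0] with n hn
  exact Real.sqrt_pos.2 (by exact_mod_cast hn)

theorem tendsto_of_tendsto_sqrt_mul {u : ℕ → ℝ} {c : ℝ}
    (hu : Tendsto (fun n : ℕ => √(n : ℝ) * u n) atTop (𝓝 c)) : Tendsto u atTop (𝓝 0) := by
  have := tendsto_inv_sqrt_natCast.mul hu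
  rw [zero_mul] at this
  refine this.congr' ?_
  filter_upwards [eventually_sqrt_natCast_pos] with n hn
  field_simp

/-- The normalized double sum over observation times and curves. -/
def avg (n : ℕ) (u : Fin n → Fin (K + 1) → ℝ) : ℝ := (n : ℝ)⁻¹ * ∑ i, ∑ j, u i j

theorem tendsto_avg_zero {u : (n : ℕ) → Fin n → Fin (K + 1) → ℝ}
    (hu : ∀ ε : ℝ, 0 < ε → ∀ᶠ n in atTop, ∀ i j, |u n i j| ≤ ε) :
    Tendsto (fun n => avg n (u n)) atTop (𝓝 0) := by
  rw [Metric.tendsto_nhds]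
  intro ε hε
  filter_upwards [hu (ε / (2 * (K + 1))) (by positivity), eventually_gt_atTop 0] with n hn hn0
  have hn0' : (0 : ℝ) < n := by exact_mod_cast hn0
  rw [dist_zero_right, avg, norm_mul, norm_inv, Real.norm_natCast]
  have : ‖∑ i, ∑ j, u n i j‖ ≤ ∑ _i : Fin n, ∑ _j : Fin (K + 1), ε / (2 * (K + 1)) :=
    norm_sum_le_of_le _ fun i _ => norm_sum_le_of_le _ fun j _ => hn i j
  calc (n : ℝ)⁻¹ * ‖∑ i, ∑ j, u n i j‖
      ≤ (n : ℝ)⁻¹ * ∑ _i : Fin n, ∑ _j : Fin (K + 1), ε / (2 * (K + 1)) := by gcongr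
    _ = ε / 2 := by
      simp only [Finset.sum_const, Finset.card_univ, Fintype.card_fin, nsmul_eq_mul]
      push_cast
      field_simp
    _ < ε := by linarith

theorem tendsto_avg_of_uniform {u v : (n : ℕ) → Fin n → Fin (K + 1) → ℝ} {c : ℝ}
    (hv : Tendsto (fun n => avg n (v n)) atTop (𝓝 c))
    (huv : ∀ ε : ℝ, 0 < ε → ∀ᶠ n in atTop, ∀ i j, |u n i j - v n i j| ≤ ε) :
    Tendsto (fun n => avg n (u n)) atTop (𝓝 c) := by
  have := (tendsto_avg_zero huv).add hv
  rw [zero_add] at this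
  refine this.congr fun n => ?_
  simp only [avg, Finset.sum_sub_distrib]
  ring

theorem tendsto_avg_coefA_sq (α : Param K) (f : F0) (hf : Continuous (deriv f.1))
    (h : Tangent K) :
    Tendsto (fun n => avg n fun i j => coefA n α f h i j ^ 2) atTop
      (𝓝 (∑ j, innerL2 (score α f h j) (score α f h j))) := by
  have h1 := fun j => tendsto_riemann_sum (g := fun t => score α f h j t * score α f h j t)
    ((continuous_score α f hf h j).mul (continuous_score α f hf h j))
    (fun t => by simp only [periodic_score α f h j t]) (α.θ j)
  refine (tendsto_finsetSum Finset.univ fun j _ => h1 j).congr fun n => ?_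
  rw [avg, Finset.sum_comm, Finset.mul_sum]
  simp only [coefA, sq]

theorem exists_bound_coefA (α : Param K) (f : F0) (hf : Continuous (deriv f.1))
    (h : Tangent K) : ∃ B : ℝ, 0 < B ∧ ∀ n i j, |coefA n α f h i j| ≤ B := by
  have h1 : ∀ j, ∃ B, ∀ t, |score α f h j t| ≤ B := fun j => by
    obtain ⟨B, hB⟩ := (isCompact_Icc (a := (0 : ℝ)) (b := 2 * Real.pi)).exists_bound_of_continuousOn
      (continuous_score α f hf h j).continuousOn
    refine ⟨B, fun t => ?_⟩
    obtain ⟨s, hs, hst⟩ := (periodic_score α f h j).exists_mem_Ico₀ (by positivity) t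
    rw [hst]
    exact hB s ⟨hs.1, hs.2.le⟩
  choose B hB using h1
  have hB0 : ∀ j, 0 ≤ B j := fun j => (abs_nonneg _).trans (hB j 0)
  refine ⟨1 + ∑ j, B j, ?_, fun n i j => (hB j _).trans ?_⟩
  · have := Finset.sum_nonneg fun j (_ : j ∈ Finset.univ) => hB0 j
    linarith
  · have := Finset.single_le_sum (fun j _ => hB0 j) (Finset.mem_univ j)
    linarith

theorem tangentForm_self (α : Param K) (f : F0) (h : Tangent K) :
    tangentForm α f h h = 2 * (K + 1) * (h.dσ / α.σ) ^ 2
      + (1 / α.σ) ^ 2 * ∑ j, innerL2 (score α f h j) (score α f h j) := by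
  rw [tangentForm_eq_sum, div_pow, div_pow, one_pow]
  ring

theorem centralSeq_eq_quadSum (n : ℕ) (α : Param K) (f : F0) (h : Tangent K)
    (y : Fin n → Fin (K + 1) → ℝ) :
    centralSeq n α f h y = quadSum α f ((√(n : ℝ))⁻¹ * (h.dσ / α.σ))
      (fun i j => (√(n : ℝ))⁻¹ * (1 / α.σ * coefA n α f h i j)) y := by
  simp only [centralSeq, quadSum, Finset.mul_sum, one_div]
  exact Finset.sum_congr rfl fun i _ => Finset.sum_congr rfl fun j _ => by ring

theorem sum_sq_inv_sqrt_mul (n : ℕ) (u : Fin n → Fin (K + 1) → ℝ) :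
    ∑ i, ∑ j, ((√(n : ℝ))⁻¹ * u i j) ^ 2 = avg n fun i j => u i j ^ 2 := by
  simp only [avg, mul_pow, inv_pow, Real.sq_sqrt (Nat.cast_nonneg n), ← Finset.mul_sum]

theorem tendstoInDistribution_centralSeq {α : Param K} (hσ : 0 < α.σ) (f : F0)
    (hf : Continuous (deriv f.1)) (h : Tangent K) :
    TendstoInDistribution (fun n : ℕ => centralSeq n α f h) atTop (id : ℝ → ℝ)
      (fun n : ℕ => obsLaw n α f) (gaussianReal 0 (Real.toNNReal (tangentForm α f h h))) := by
  have hb : Tendsto (fun n : ℕ => √(n : ℝ) * ((√(n : ℝ))⁻¹ * (h.dσ / α.σ))) atTop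
      (𝓝 (h.dσ / α.σ)) := by
    refine tendsto_const_nhds.congr' ?_
    filter_upwards [eventually_sqrt_natCast_pos] with n hn
    rw [mul_inv_cancel_left₀ hn.ne']
  have hc : Tendsto (fun n : ℕ => ∑ i, ∑ j, ((√(n : ℝ))⁻¹ * (1 / α.σ * coefA n α f h i j)) ^ 2)
      atTop (𝓝 ((1 / α.σ) ^ 2 * ∑ j, innerL2 (score α f h j) (score α f h j))) := by
    refine ((tendsto_avg_coefA_sq α f hf h).const_mul ((1 / α.σ) ^ 2)).congr fun n => ?_
    rw [sum_sq_inv_sqrt_mul]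
    simp only [avg, mul_pow, ← Finset.mul_sum]
    ring
  have := tendstoInDistribution_quadSum hσ f hb hc
    (tendsto_const_nhds (x := (0 : ℝ)) (f := atTop))
  simpa only [add_zero, ← tangentForm_self, ← centralSeq_eq_quadSum] using this

/-- Convergence in distribution to `0` implies convergence to `0` in probability. -/
theorem isLittleOP_of_tendstoInDistribution_dirac {Ω : ℕ → Type} [∀ n, MeasurableSpace (Ω n)]
    {P : (n : ℕ) → Measure (Ω n)} [∀ n, IsProbabilityMeasure (P n)] {R : (n : ℕ) → Ω n → ℝ}
    (h : TendstoInDistribution R atTop (id : ℝ → ℝ) P (Measure.dirac 0)) : IsLittleOP P R := by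
  intro δ hδ
  have hcl : IsClosed {x : ℝ | δ ≤ |x|} := isClosed_le continuous_const continuous_abs
  have h0 : (Measure.dirac (0 : ℝ)) {x : ℝ | δ ≤ |x|} = 0 := by
    rw [Measure.dirac_apply' _ hcl.measurableSet]
    simp [hδ]
  have := ProbabilityMeasure.tendsto_measure_of_null_frontier_of_tendsto' h.tendsto
    (E := {x : ℝ | δ ≤ |x|})
    (by
      simp only [ProbabilityMeasure.coe_mk, Measure.map_id]
      exact measure_mono_null hcl.frontier_subset h0)
  simp only [ProbabilityMeasure.coe_mk, Measure.map_id, h0] at this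
  refine this.congr fun n => ?_
  rw [Measure.map_apply_of_aemeasurable (h.forall_aemeasurable n) hcl.measurableSet]
  rfl

theorem IsLittleOP.congr_ae {Ω : ℕ → Type} [∀ n, MeasurableSpace (Ω n)]
    {P : (n : ℕ) → Measure (Ω n)} {R R' : (n : ℕ) → Ω n → ℝ} (h : IsLittleOP P R)
    (hR : ∀ n, R n =ᵐ[P n] R' n) : IsLittleOP P R' := fun δ hδ =>
  (h δ hδ).congr fun n => measure_congr <| by
    filter_upwards [hR n] with y hy
    exact congrArg (fun x : ℝ => δ ≤ |x|) hy

theorem real_log_one_sub_two_mul_isLittleO :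
    (fun z : ℝ => -(1 / 2) * Real.log (1 - 2 * z) - z - z ^ 2) =o[𝓝 0] fun z => z ^ 2 := by
  have h0 : Tendsto (fun z : ℝ => (z : ℂ)) (𝓝 0) (𝓝 0) := by
    simpa using Complex.continuous_ofReal.tendsto 0
  rw [← Complex.isLittleO_ofReal_left, ← Complex.isLittleO_ofReal_right]
  refine (log_one_sub_two_mul_isLittleO.comp_tendsto h0).congr' ?_
    (Eventually.of_forall fun z => by simp)
  filter_upwards [eventually_lt_nhds (show (0 : ℝ) < 1 / 2 by norm_num)] with z hz
  have : (1 : ℂ) - 2 * z = ((1 - 2 * z : ℝ) : ℂ) := by push_cast; rfl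
  simp only [Function.comp, this, ← Complex.ofReal_log (show 0 ≤ 1 - 2 * z by linarith)]
  push_cast
  rfl

/-- Local asymptotic normality along any sequence of parameters whose regression functions
admit the first-order expansion given by the tangent functions. -/
theorem isLittleOP_logLikRatio_sub {α : Param K} (hσ : 0 < α.σ) (f : F0)
    (hf : Continuous (deriv f.1)) (h : Tangent K) {αn : ℕ → Param K} {fn : ℕ → F0}
    (hσn : ∀ n, 0 < (αn n).σ)
    (hσl : Tendsto (fun n : ℕ => √(n : ℝ) * ((αn n).σ - α.σ)) atTop (𝓝 h.dσ))
    (hm : ∀ ε : ℝ, 0 < ε → ∀ᶠ n : ℕ in atTop, ∀ (i : Fin n) j,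
      |√(n : ℝ) * (mean (αn n) (fn n) (time n i) j - mean α f (time n i) j)
        - coefA n α f h i j| ≤ ε) :
    IsLittleOP (fun n : ℕ => obsLaw n α f) (fun n y =>
      logLikRatio n α f (αn n) (fn n) y
        - (centralSeq n α f h y - 1 / 2 * tangentForm α f h h)) := by
  set D : (n : ℕ) → Fin n → Fin (K + 1) → ℝ := fun n i j =>
    √(n : ℝ) * (mean (αn n) (fn n) (time n i) j - mean α f (time n i) j) with hD
  set V := ∑ j, innerL2 (score α f h j) (score α f h j) with hV
  obtain ⟨B, hB, hAB⟩ := exists_bound_coefA α f hf h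
  have hAA := tendsto_avg_coefA_sq α f hf h
  have hDA : Tendsto (fun n => avg n fun i j => D n i j * coefA n α f h i j) atTop (𝓝 V) := by
    refine tendsto_avg_of_uniform hAA fun ε hε => ?_
    filter_upwards [hm (ε / B) (by positivity)] with n hn i j
    rw [sq, ← sub_mul, abs_mul]
    calc _ ≤ ε / B * B := mul_le_mul (hn i j) (hAB n i j) (abs_nonneg _) (by positivity)
      _ = ε := by field_simp
  have hDD : Tendsto (fun n => avg n fun i j => D n i j ^ 2) atTop (𝓝 V) := by
    refine tendsto_avg_of_uniform hDA fun ε hε => ?_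
    filter_upwards [hm (ε / (B + 1)) (by positivity), hm 1 one_pos] with n hn hn1 i j
    rw [sq, ← mul_sub, abs_mul]
    have h1 : |D n i j| ≤ B + 1 := by
      have := abs_add_le (D n i j - coefA n α f h i j) (coefA n α f h i j)
      rw [sub_add_cancel] at this
      linarith [hn1 i j, hAB n i j]
    calc _ ≤ (B + 1) * (ε / (B + 1)) := mul_le_mul h1 (hn i j) (abs_nonneg _) (by positivity)
      _ = ε := by field_simp
  have hσt : Tendsto (fun n => (αn n).σ) atTop (𝓝 α.σ) := by
    simpa using (tendsto_of_tendsto_sqrt_mul hσl).add_const α.σ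
  set z : ℕ → ℝ := fun n => (1 - α.σ ^ 2 / (αn n).σ ^ 2) / 2 with hz
  -- Here `z n = (σ_n - σ)(σ_n + σ) / (2 σ_n²)`.
  have hzl : Tendsto (fun n : ℕ => √(n : ℝ) * z n) atTop (𝓝 (h.dσ / α.σ)) := by
    have h1 := (hσl.mul ((hσt.add_const α.σ).div ((hσt.pow 2).const_mul 2) (by positivity)))
    convert! h1 using 2 with n
    · have := (hσn n).ne'
      simp only [hz, Pi.div_apply]
      field_simp
      ring
    · field_simp
      ring
  have hz0 := tendsto_of_tendsto_sqrt_mul hzl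
  have hzz : Tendsto (fun n : ℕ => (n : ℝ) * z n ^ 2) atTop (𝓝 ((h.dσ / α.σ) ^ 2)) := by
    refine (hzl.pow 2).congr fun n => ?_
    rw [mul_pow, Real.sq_sqrt (Nat.cast_nonneg n)]
  -- Since `1 - 2 z n = (σ / σ_n)²`, the logarithm is `(1/2) log (1 - 2 z n)`, and its second-order
  -- expansion leaves `-n (z n)²`.
  have hlog : Tendsto (fun n : ℕ => (n : ℝ) * (Real.log (α.σ / (αn n).σ) + z n)) atTop
      (𝓝 (-(h.dσ / α.σ) ^ 2)) := by
    have h1 := (Asymptotics.isBigO_refl (fun n : ℕ => (n : ℝ)) atTop).mul_isLittleO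
      (real_log_one_sub_two_mul_isLittleO.comp_tendsto hz0)
    have h2 := (h1.trans_isBigO (hzz.isBigO_one ℝ)).tendsto_zero_of_tendsto tendsto_const_nhds
    have h3 := (h2.add hzz).neg
    rw [zero_add] at h3
    refine h3.congr fun n => ?_
    have : 1 - 2 * z n = (α.σ / (αn n).σ) ^ 2 := by
      simp only [hz, div_pow]
      ring
    simp only [Function.comp, this, Real.log_pow]
    push_cast
    ring
  have hr : Tendsto (fun n => α.σ / (αn n).σ ^ 2) atTop (𝓝 (1 / α.σ)) := by
    have := (tendsto_const_nhds (x := α.σ)).div (hσt.pow 2) (by positivity)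
    convert! this using 2
    field_simp
  -- `b`, `c`, `κ` are the quadratic, linear and constant coefficients of the LAN remainder; each is
  -- shown to be negligible at its own scale.
  set b : ℕ → ℝ := fun n => z n - (√(n : ℝ))⁻¹ * (h.dσ / α.σ) with hb
  set c : (n : ℕ) → Fin n → Fin (K + 1) → ℝ := fun n i j =>
    α.σ * (mean (αn n) (fn n) (time n i) j - mean α f (time n i) j) / (αn n).σ ^ 2
      - (√(n : ℝ))⁻¹ * (1 / α.σ * coefA n α f h i j) with hc
  set κ : ℕ → ℝ := fun n =>
    (n * (K + 1) * (Real.log (α.σ / (αn n).σ) + z n)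
        - ∑ i : Fin n, ∑ j, (mean (αn n) (fn n) (time n i) j - mean α f (time n i) j) ^ 2
          / (2 * (αn n).σ ^ 2)) + 1 / 2 * tangentForm α f h h with hκ
  have hmean : ∀ n : ℕ, 0 < √(n : ℝ) → ∀ (i : Fin n) j,
      mean (αn n) (fn n) (time n i) j - mean α f (time n i) j = (√(n : ℝ))⁻¹ * D n i j :=
    fun n hn i j => by rw [hD, inv_mul_cancel_left₀ hn.ne']
  have hbl : Tendsto (fun n : ℕ => √(n : ℝ) * b n) atTop (𝓝 0) := by
    have := hzl.sub_const (h.dσ / α.σ)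
    rw [sub_self] at this
    refine this.congr' ?_
    filter_upwards [eventually_sqrt_natCast_pos] with n hn
    rw [hb, mul_sub, mul_inv_cancel_left₀ hn.ne']
  -- Expanding the square, the three averages all tend to `V`, with weights `1`, `-2`, `1` times `1
  -- / σ²`.
  have hcl : Tendsto (fun n : ℕ => ∑ i, ∑ j, c n i j ^ 2) atTop (𝓝 0) := by
    have := (((hr.pow 2).mul hDD).sub (((hr.mul_const (1 / α.σ)).const_mul 2).mul hDA)).add
      (hAA.const_mul ((1 / α.σ) ^ 2))
    rw [← hV, show (1 / α.σ) ^ 2 * V - 2 * (1 / α.σ * (1 / α.σ)) * V + (1 / α.σ) ^ 2 * V = 0 by ring]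
      at this
    refine this.congr' ?_
    filter_upwards [eventually_sqrt_natCast_pos] with n hn
    have h1 : ∀ i j, c n i j = (√(n : ℝ))⁻¹
        * (α.σ / (αn n).σ ^ 2 * D n i j - 1 / α.σ * coefA n α f h i j) := fun i j => by
      simp only [hc]
      rw [hmean n hn]
      ring
    simp only [h1, sum_sq_inv_sqrt_mul]
    simp only [avg, Finset.mul_sum, ← Finset.sum_sub_distrib, ← Finset.sum_add_distrib]
    exact Finset.sum_congr rfl fun i _ => Finset.sum_congr rfl fun j _ => by ring
  have hκl : Tendsto κ atTop (𝓝 0) := by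
    have := ((hlog.mul_const ((K : ℝ) + 1)).sub
      (hDD.div ((hσt.pow 2).const_mul 2) (by positivity))).add_const
        (1 / 2 * tangentForm α f h h)
    -- The deterministic part of the log-likelihood ratio tends to minus half the squared norm.
    have h0 : -(h.dσ / α.σ) ^ 2 * ((K : ℝ) + 1) - V / (2 * α.σ ^ 2)
        + 1 / 2 * tangentForm α f h h = 0 := by
      rw [tangentForm_self, ← hV]
      field_simp
      ring
    rw [h0] at this
    refine this.congr' ?_
    filter_upwards [eventually_sqrt_natCast_pos] with n hn
    simp only [hκ, ← Finset.sum_div]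
    simp only [hmean n hn, sum_sq_inv_sqrt_mul, Pi.div_apply]
    ring
  have key := tendstoInDistribution_quadSum hσ f hbl hcl hκl
  simp only [ne_eq, OfNat.ofNat_ne_zero, not_false_eq_true, zero_pow, mul_zero, add_zero,
    Real.toNNReal_zero, gaussianReal_zero_var] at key
  refine (isLittleOP_of_tendstoInDistribution_dirac key).congr_ae fun n => ?_
  filter_upwards [logLikRatio_ae_eq hσ (hσn n) f (fn n) n] with y hy
  rw [hy, centralSeq_eq_quadSum]
  have : quadSum α f (b n) (c n) y = quadSum α f (z n)
      (fun i j => α.σ * (mean (αn n) (fn n) (time n i) j - mean α f (time n i) j)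
        / (αn n).σ ^ 2) y
      - quadSum α f ((√(n : ℝ))⁻¹ * (h.dσ / α.σ))
        (fun i j => (√(n : ℝ))⁻¹ * (1 / α.σ * coefA n α f h i j)) y := by
    simp only [quadSum, ← Finset.sum_sub_distrib]
    exact Finset.sum_congr rfl fun i _ => Finset.sum_congr rfl fun j _ => by
      simp only [hb, hc]; ring
  rw [this]
  simp only [hκ]
  ring

/-! ### Uniform expansion of the regression curves. -/

/-- First-order expansion, uniform on compact sets, of a shifted, scaled and translated curve. -/
theorem tendstoUniformlyOn_curve_expansion {f g : ℝ → ℝ} (hfd : Differentiable ℝ f)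
    (hfc : Continuous (deriv f)) (hg : Continuous g) {a υ p : ℕ → ℝ} {a₀ υ₀ a' υ' p' : ℝ}
    (ha : Tendsto (fun n : ℕ => √(n : ℝ) * (a n - a₀)) atTop (𝓝 a'))
    (hυ : Tendsto (fun n : ℕ => √(n : ℝ) * (υ n - υ₀)) atTop (𝓝 υ'))
    (hp : Tendsto (fun n : ℕ => √(n : ℝ) * p n) atTop (𝓝 p')) {S : Set ℝ} (hS : IsCompact S) :
    TendstoUniformlyOn
      (fun (n : ℕ) s => √(n : ℝ)
        * (a n * (f (s - p n) + (√(n : ℝ))⁻¹ * g (s - p n)) + υ n - (a₀ * f s + υ₀)))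
      (fun s => a' * f s + a₀ * g s - p' * a₀ * deriv f s + υ') atTop S := by
  rw [← tendstoLocallyUniformlyOn_iff_tendstoUniformlyOn_of_compact hS,
    tendstoLocallyUniformlyOn_iff_forall_tendsto]
  intro x hx
  set 𝓕 : Filter (ℕ × ℝ) := atTop ×ˢ 𝓝[S] x
  have hfst : Tendsto Prod.fst 𝓕 atTop := tendsto_fst
  have hs : Tendsto (fun q : ℕ × ℝ => q.2) 𝓕 (𝓝 x) := tendsto_snd.mono_right nhdsWithin_le_nhds
  have hat : Tendsto a atTop (𝓝 a₀) := by
    simpa using (tendsto_of_tendsto_sqrt_mul ha).add_const a₀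
  have hsp : Tendsto (fun q : ℕ × ℝ => q.2 - p q.1) 𝓕 (𝓝 x) := by
    simpa using hs.sub ((tendsto_of_tendsto_sqrt_mul hp).comp hfst)
  have hlim : Continuous fun s => a' * f s + a₀ * g s - p' * a₀ * deriv f s + υ' := by
    have := hfd.continuous
    fun_prop
  -- Strictness is needed because both points `s - p n` and `s` vary near `x`.
  have hstrict : HasStrictDerivAt f (deriv f x) x :=
    hasStrictDerivAt_of_hasDerivAt_of_continuousAt
      (Eventually.of_forall fun y => (hfd y).hasDerivAt) hfc.continuousAt
  have hpq : Tendsto (fun q : ℕ × ℝ => √(q.1 : ℝ) * (-p q.1)) 𝓕 (𝓝 (-p')) := by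
    simpa using (hp.comp hfst).neg
  have hdf : Tendsto (fun q : ℕ × ℝ => √(q.1 : ℝ) * (f (q.2 - p q.1) - f q.2)) 𝓕
      (𝓝 (-p' * deriv f x)) := by
    have h1 := hstrict.isLittleO.comp_tendsto (hsp.prodMk_nhds hs)
    have h2 := (Asymptotics.isBigO_refl (fun q : ℕ × ℝ => √(q.1 : ℝ)) 𝓕).mul_isLittleO h1
    have h3 : Tendsto (fun q : ℕ × ℝ => √(q.1 : ℝ) * (f (q.2 - p q.1) - f q.2
        - (-p q.1) * deriv f x)) 𝓕 (𝓝 0) := by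
      refine ((h2.congr (fun q => ?_) fun q => ?_).trans_isBigO
        (hpq.isBigO_one ℝ)).tendsto_zero_of_tendsto tendsto_const_nhds
      · simp
      · simp [Function.comp]
    have h4 := h3.add (hpq.mul_const (deriv f x))
    rw [zero_add] at h4
    exact h4.congr fun q => by ring
  have hcurve := ((((ha.comp hfst).mul ((hfd.continuous.tendsto x).comp hsp)).add
    (hdf.const_mul a₀)).add ((hat.comp hfst).mul ((hg.tendsto x).comp hsp))).add (hυ.comp hfst)
  have hQ : Tendsto (fun q : ℕ × ℝ => √(q.1 : ℝ)
        * (a q.1 * (f (q.2 - p q.1) + (√(q.1 : ℝ))⁻¹ * g (q.2 - p q.1)) + υ q.1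
          - (a₀ * f q.2 + υ₀))) 𝓕
      (𝓝 (a' * f x + a₀ * g x - p' * a₀ * deriv f x + υ')) := by
    have : a' * f x + a₀ * g x - p' * a₀ * deriv f x + υ'
      = a' * f x + a₀ * (-p' * deriv f x) + a₀ * g x + υ' := by ring
    rw [this]
    refine hcurve.congr' ?_
    filter_upwards [hfst.eventually eventually_sqrt_natCast_pos] with q hq
    simp only [Function.comp]
    field_simp
    ring
  exact (((hlim.tendsto x).comp hs).prodMk_nhds hQ).mono_right (nhds_le_uniformity _)

theorem tendsto_sqrt_mul_linear (x y : ℝ) :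
    Tendsto (fun n : ℕ => √(n : ℝ) * (x + y * (√(n : ℝ))⁻¹ - x)) atTop (𝓝 y) := by
  refine tendsto_const_nhds.congr' ?_
  filter_upwards [eventually_sqrt_natCast_pos] with n hn
  field_simp
  ring

theorem tendsto_sqrt_mul_of_hasDerivAt {x : ℝ → ℝ} {x' : ℝ} (hx : HasDerivAt x x' 0) :
    Tendsto (fun n : ℕ => √(n : ℝ) * (x (√(n : ℝ))⁻¹ - x 0)) atTop (𝓝 x') := by
  have h1 : Tendsto (fun n : ℕ => (√(n : ℝ))⁻¹) atTop (𝓝[≠] 0) :=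
    tendsto_nhdsWithin_iff.2 ⟨tendsto_inv_sqrt_natCast, by
      filter_upwards [eventually_sqrt_natCast_pos] with n hn
      exact inv_ne_zero hn.ne'⟩
  refine ((hasDerivAt_iff_tendsto_slope_zero.1 hx).comp h1).congr fun n => ?_
  simp

/-! ### An admissible path in each direction. -/

/-- A path in the parameter space through `α` with tangent `h`. The first amplitude is determined
by the normalization of the amplitudes, and the shifts are reduced modulo `2π`. -/
def path (α : Param K) (h : Tangent K) (δ : ℝ) : Param K where
  θ := Fin.cases 0 fun k => toIcoMod Real.two_pi_pos 0 (α.θ k.succ + h.dθ k * δ)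
  a := Fin.cases (√((K + 1 : ℝ) - ∑ k : Fin K, (α.a k.succ + h.da k * δ) ^ 2))
    fun k => α.a k.succ + h.da k * δ
  υ j := α.υ j + h.dυ j * δ
  σ := α.σ + h.dσ * δ

theorem path_a_zero (α : Param K) (h : Tangent K) (δ : ℝ) : (path α h δ).a 0
    = √((K + 1 : ℝ) - ∑ k : Fin K, (α.a k.succ + h.da k * δ) ^ 2) := rfl

theorem path_a_succ (α : Param K) (h : Tangent K) (δ : ℝ) (k : Fin K) :
    (path α h δ).a k.succ = α.a k.succ + h.da k * δ := rfl

section path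

variable {υmax : ℝ} {α : Param K}

theorem sub_sum_sq_eq (hα : α.IsAdmissible υmax) :
    (K + 1 : ℝ) - ∑ k : Fin K, α.a k.succ ^ 2 = α.a 0 ^ 2 := by
  rw [← hα.sum_sq, Fin.sum_univ_succ]
  ring

theorem path_a_zero_zero (hα : α.IsAdmissible υmax) (h : Tangent K) :
    (path α h 0).a 0 = α.a 0 := by
  simp only [path_a_zero, mul_zero, add_zero]
  rw [sub_sum_sq_eq hα, Real.sqrt_sq hα.a_ref_pos.le]

theorem hasDerivAt_path_a_zero (hα : α.IsAdmissible υmax) (h : Tangent K) :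
    HasDerivAt (fun δ => (path α h δ).a 0) (-∑ k : Fin K, h.da k * (α.a k.succ / α.a 0)) 0 := by
  have h1 : ∀ k : Fin K, HasDerivAt (fun δ : ℝ => (α.a k.succ + h.da k * δ) ^ 2)
      (2 * α.a k.succ * h.da k) 0 := fun k => by
    have := (((hasDerivAt_id (0 : ℝ)).const_mul (h.da k)).const_add (α.a k.succ)).fun_pow 2
    simpa using this
  have h2 := (HasDerivAt.fun_sum (u := Finset.univ) fun k _ => h1 k).const_sub (K + 1 : ℝ)
  -- The square root is differentiable here: by the normalization its radicand at `0` is `a_0² > 0`.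
  have h3 := h2.sqrt (by
    simp only [mul_zero, add_zero]
    rw [sub_sum_sq_eq hα]
    exact (pow_pos hα.a_ref_pos 2).ne')
  refine h3.congr_deriv ?_
  simp only [mul_zero, add_zero]
  rw [sub_sum_sq_eq hα, Real.sqrt_sq hα.a_ref_pos.le, neg_div, Finset.sum_div]
  congr 1
  refine Finset.sum_congr rfl fun k _ => ?_
  have := hα.a_ref_pos.ne'
  field_simp

theorem eventually_path_isAdmissible (hα : α.IsAdmissible υmax) (hυ : ∀ j, |α.υ j| < υmax)
    (h : Tangent K) : ∀ᶠ δ in 𝓝 (0 : ℝ), (path α h δ).IsAdmissible υmax := by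
  have hlin : ∀ x y : ℝ, Tendsto (fun δ : ℝ => x + y * δ) (𝓝 0) (𝓝 x) := fun x y => by
    have : Continuous fun δ : ℝ => x + y * δ := by fun_prop
    simpa using this.tendsto 0
  have hrad : Tendsto (fun δ : ℝ => (K + 1 : ℝ) - ∑ k : Fin K, (α.a k.succ + h.da k * δ) ^ 2)
      (𝓝 0) (𝓝 (α.a 0 ^ 2)) := by
    rw [← sub_sum_sq_eq hα]
    exact (tendsto_finsetSum _ fun k _ => (hlin _ _).pow 2).const_sub _
  have e1 := hrad.eventually (eventually_gt_nhds (pow_pos hα.a_ref_pos 2))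
  have e2 : ∀ᶠ δ in 𝓝 (0 : ℝ), ∀ j, |α.υ j + h.dυ j * δ| < υmax :=
    eventually_all.2 fun j => (hlin _ _).abs.eventually (eventually_lt_nhds (hυ j))
  have e3 := (hlin α.σ h.dσ).eventually (eventually_gt_nhds hα.σ_pos)
  filter_upwards [e1, e2, e3] with δ h1 h2 h3
  refine ⟨fun j => ?_, fun j => abs_le.1 (h2 j).le, rfl, ?_, Real.sqrt_pos.2 h1, h3⟩
  · refine Fin.cases ?_ (fun k => ?_) j
    · exact ⟨le_rfl, by positivity⟩
    · have := toIcoMod_mem_Ico' Real.two_pi_pos (α.θ k.succ + h.dθ k * δ)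
      exact ⟨this.1, this.2.le⟩
  · rw [Fin.sum_univ_succ, path_a_zero, Real.sq_sqrt h1.le]
    simp only [path_a_succ]
    ring

/-- Periodicity undoes the reduction of the shifts modulo `2π`, leaving a shift linear in `δ` to
which the curve expansion applies. -/
theorem mean_path (hα : α.IsAdmissible υmax) (f : F0) (h : Tangent K) (δ t : ℝ)
    (j : Fin (K + 1)) :
    mean (path α h δ) (f + δ • h.2.2.2.2) t j
      = (path α h δ).a j * (f.1 (t - α.θ j - Fin.cases 0 h.dθ j * δ)
        + δ * h.df (t - α.θ j - Fin.cases 0 h.dθ j * δ)) + (α.υ j + h.dυ j * δ) := by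
  have key : ∀ g : F0, g.1 (t - (path α h δ).θ j)
      = g.1 (t - α.θ j - Fin.cases 0 h.dθ j * δ) := fun g => by
    refine Fin.cases ?_ (fun k => ?_) j
    · change g.1 (t - 0) = g.1 (t - α.θ 0 - 0 * δ)
      rw [hα.θ_ref, zero_mul, sub_zero, sub_zero]
    · change g.1 (t - toIcoMod Real.two_pi_pos 0 (α.θ k.succ + h.dθ k * δ))
        = g.1 (t - α.θ k.succ - h.dθ k * δ)
      rw [toIcoMod, ← sub_add, zsmul_eq_mul, ← sub_sub]
      exact (F0_periodic g).int_mul _ _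
  change (path α h δ).a j * (f.1 (t - (path α h δ).θ j)
    + δ * h.2.2.2.2.1 (t - (path α h δ).θ j)) + _ = _
  rw [key f, key h.2.2.2.2]
  rfl

theorem approachesAlong_path (h : Tangent K) (f : F0) :
    ApproachesAlong α f h (fun n => path α h (√(n : ℝ))⁻¹)
      (fun n => f + (√(n : ℝ))⁻¹ • h.2.2.2.2) := by
  have hlin := tendsto_sqrt_mul_linear
  -- The integers `m` are the numbers of full turns removed by `toIcoMod`.
  refine ⟨⟨fun n k => toIcoDiv Real.two_pi_pos 0 (α.θ k.succ + h.dθ k * (√(n : ℝ))⁻¹),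
    fun k => ?_⟩, fun k => hlin _ _, fun j => hlin _ _, hlin _ _, ?_⟩
  · refine (hlin (α.θ k.succ) (h.dθ k)).congr fun n => ?_
    congr 2
    change _ = toIcoMod Real.two_pi_pos 0 (α.θ k.succ + h.dθ k * (√(n : ℝ))⁻¹) + _
    rw [toIcoMod, zsmul_eq_mul]
    ring
  · rw [Metric.tendstoUniformly_iff]
    intro ε hε
    filter_upwards [eventually_sqrt_natCast_pos] with n hn t
    change dist (h.df t) (√(n : ℝ) * (f.1 t + (√(n : ℝ))⁻¹ * h.df t - f.1 t)) < ε
    rw [add_sub_cancel_left, mul_inv_cancel_left₀ hn.ne', dist_self]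
    exact hε

theorem mean_path_expansion (hα : α.IsAdmissible υmax) (f : F0) (hfd : Differentiable ℝ f.1)
    (hfc : Continuous (deriv f.1)) (h : Tangent K) {ε : ℝ} (hε : 0 < ε) :
    ∀ᶠ n : ℕ in atTop, ∀ (i : Fin n) j,
      |√(n : ℝ) * (mean (path α h (√(n : ℝ))⁻¹) (f + (√(n : ℝ))⁻¹ • h.2.2.2.2) (time n i) j
        - mean α f (time n i) j) - coefA n α f h i j| ≤ ε := by
  have hlin := tendsto_sqrt_mul_linear
  have hp : ∀ y : ℝ, Tendsto (fun n : ℕ => √(n : ℝ) * (y * (√(n : ℝ))⁻¹)) atTop (𝓝 y) :=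
    fun y => by simpa using hlin 0 y
  have ha : ∀ j, Tendsto (fun n : ℕ => √(n : ℝ) * ((path α h (√(n : ℝ))⁻¹).a j - α.a j)) atTop
      (𝓝 (Fin.cases (-∑ k : Fin K, h.da k * (α.a k.succ / α.a 0)) h.da j)) := fun j => by
    refine Fin.cases ?_ (fun k => ?_) j
    · have := tendsto_sqrt_mul_of_hasDerivAt (hasDerivAt_path_a_zero hα h)
      rw [path_a_zero_zero hα] at this
      exact this
    · exact hlin _ _
  -- This interval contains every `t_i - θ_j`, as times and shifts both lie in `[0, 2π]`.
  have hall : ∀ᶠ n : ℕ in atTop, ∀ j, ∀ s ∈ Set.Icc (-(2 * Real.pi)) (2 * Real.pi),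
      dist (Fin.cases (-∑ k : Fin K, h.da k * (α.a k.succ / α.a 0)) h.da j * f.1 s
        + α.a j * h.df s - Fin.cases 0 h.dθ j * α.a j * deriv f.1 s + h.dυ j)
        (√(n : ℝ) * ((path α h (√(n : ℝ))⁻¹).a j
          * (f.1 (s - Fin.cases 0 h.dθ j * (√(n : ℝ))⁻¹)
            + (√(n : ℝ))⁻¹ * h.df (s - Fin.cases 0 h.dθ j * (√(n : ℝ))⁻¹))
          + (α.υ j + h.dυ j * (√(n : ℝ))⁻¹) - (α.a j * f.1 s + α.υ j))) < ε :=
    eventually_all.2 fun j => Metric.tendstoUniformlyOn_iff.1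
      (tendstoUniformlyOn_curve_expansion hfd hfc (F0_continuous h.2.2.2.2) (ha j)
        (hlin (α.υ j) (h.dυ j)) (hp _) isCompact_Icc) ε hε
  filter_upwards [hall] with n hn i j
  have hi : time n i ∈ Set.Icc 0 (2 * Real.pi) := by
    have : (i : ℝ) / n ≤ 1 := div_le_one_of_le₀ (by exact_mod_cast i.2.le) (by positivity)
    unfold time
    exact ⟨by positivity, mul_le_of_le_one_left (by positivity) this⟩
  have hθ := hα.θ_mem j
  have := hn j (time n i - α.θ j) ⟨by linarith [hi.1, hθ.2], by linarith [hi.2, hθ.1]⟩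
  rw [dist_comm, Real.dist_eq] at this
  rw [mean_path hα]
  refine le_of_eq_of_le ?_ this.le
  congr 2
  unfold coefA
  refine Fin.cases ?_ (fun k => ?_) j
  · rw [score_zero, ← Finset.sum_mul]
    simp only [Fin.cases_zero]
    ring
  · rw [score_succ]
    simp only [Fin.cases_succ]
    ring

end path

theorem ApproachesAlong.congr {α : Param K} {f : F0} {h : Tangent K} {αn βn : ℕ → Param K}
    {fn : ℕ → F0} (H : ApproachesAlong α f h αn fn) (hαβ : αn =ᶠ[atTop] βn) :
    ApproachesAlong α f h βn fn := by
  obtain ⟨⟨m, hθ⟩, ha, hυ, hσ, hf⟩ := H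
  refine ⟨⟨m, fun k => (hθ k).congr' ?_⟩, fun k => (ha k).congr' ?_, fun j => (hυ j).congr' ?_,
    hσ.congr' ?_, hf⟩ <;>
  · filter_upwards [hαβ] with n hn
    rw [hn]

/-- Existence of an admissible sequence in every direction, with the LAN expansion. -/
theorem exists_approachesAlong_isLittleOP {υmax : ℝ} {α : Param K} {f : F0}
    (hα : α.IsAdmissible υmax) (hυ : ∀ j, |α.υ j| < υmax) (hfd : Differentiable ℝ f.1)
    (hfc : Continuous (deriv f.1)) (h : Tangent K) :
    ∃ (αn : ℕ → Param K) (fn : ℕ → F0),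
      (∀ n, (αn n).IsAdmissible υmax) ∧
      ApproachesAlong α f h αn fn ∧
      IsLittleOP (fun n : ℕ => obsLaw n α f) (fun n y =>
        logLikRatio n α f (αn n) (fn n) y
          - (centralSeq n α f h y - 1 / 2 * tangentForm α f h h)) := by
  classical
  -- The path is known to be admissible only near `0`; falling back on `α` secures admissibility for
  -- every `n` without affecting limits.
  set αn : ℕ → Param K := fun n =>
    if (path α h (√(n : ℝ))⁻¹).IsAdmissible υmax then path α h (√(n : ℝ))⁻¹ else α with hαn
  have hadm : ∀ n, (αn n).IsAdmissible υmax := fun n => by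
    simp only [hαn]
    split_ifs with H
    exacts [H, hα]
  have heq : (fun n : ℕ => path α h (√(n : ℝ))⁻¹) =ᶠ[atTop] αn := by
    filter_upwards [tendsto_inv_sqrt_natCast.eventually (eventually_path_isAdmissible hα hυ h)]
      with n hn
    simp only [hαn, if_pos hn]
  have happ := (approachesAlong_path (α := α) h f).congr heq
  refine ⟨αn, fun n => f + (√(n : ℝ))⁻¹ • h.2.2.2.2, hadm, happ,
    isLittleOP_logLikRatio_sub hα.σ_pos f hfc h (fun n => (hadm n).σ_pos) happ.σ_dir
      fun ε hε => ?_⟩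
  filter_upwards [mean_path_expansion hα f hfd hfc h hε, heq] with n hn hn'
  rwa [← hn']

end ShapeInvariant

end

open ShapeInvariant
theorem proposition3p1 (K : ℕ) (υmax : ℝ) (α : Param K) (f : F0)
    (hα : α.IsAdmissible υmax) (hυ : ∀ j, |α.υ j| < υmax)
    (hf_diff : Differentiable ℝ f.1) (hf_cont : Continuous (deriv f.1))
    (hf_nonconst : ¬ ∃ c : ℝ, ∀ t, f.1 t = c) (ha : ∀ j, α.a j ≠ 0) :
    (∃ c : InnerProductSpace.Core ℝ (Tangent K), ∀ h h', c.inner h h' = tangentForm α f h h') ∧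
    (∀ (n : ℕ) (y : Fin n → Fin (K + 1) → ℝ),
      IsLinearMap ℝ (fun h : Tangent K => centralSeq n α f h y)) ∧
    (∀ h : Tangent K,
      TendstoInDistribution (fun n : ℕ => centralSeq n α f h) atTop (id : ℝ → ℝ)
        (fun n : ℕ => obsLaw n α f) (gaussianReal 0 (Real.toNNReal (tangentForm α f h h)))) ∧
    (∀ h : Tangent K, ∃ (αn : ℕ → Param K) (fn : ℕ → F0),
      (∀ n, (αn n).IsAdmissible υmax) ∧
      ApproachesAlong α f h αn fn ∧
      IsLittleOP (fun n : ℕ => obsLaw n α f) (fun n y =>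
        logLikRatio n α f (αn n) (fn n) y
          - (centralSeq n α f h y - 1 / 2 * tangentForm α f h h))) := by
  exact ⟨exists_tangentForm_core hα.σ_pos hα.a_ref_pos hf_diff hf_cont hf_nonconst ha,
    fun n y => isLinearMap_centralSeq n α f y,
    fun h => tendstoInDistribution_centralSeq hα.σ_pos f hf_cont h,
    fun h => exists_approachesAlong_isLittleOP hα hυ hf_diff hf_cont h⟩
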